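/- Let $N\ge 1$, let $\Omega\subset\mathbb R^N$ be a bounded domain with $C^2$-boundary $\partial\Omega$ and outer unit normal $\nu$, let $\sigma$ be the $(N-1)$-dimensional Hausdorff surface measure on $\partial\Omega$ (a.e. statements on $\partial\Omega$ refer to $\sigma$), let $1<p_1,p_2<\infty$, and let $g_1,g_2\colon\partial\Omega\times\mathbb R\times\mathbb R\to\mathbb R$. Consider the system $$-\Delta_{p_i}u_i=-|u_i|^{p_i-2}u_i\ \text{ in }\Omega,\qquad |\nabla u_i|^{p_i-2}\nabla u_i\cdot\nu=g_i(x,u_1,u_2)\ \text{ on }\partial\Omega,\qquad i=1,2. \tag{P}$$ A (weak) solution of (P) is a pair $(u_1,u_2)\in W^{1,p_1}(\Omega)\times W^{1,p_2}(\Omega)$ such that, for $i=1,2$ and all $\varphi\in W^{1,p_i}(\Omega)$, the following integrals exist and (with traces on $\partial\Omega$) $$\int_\Omega|\nabla u_i|^{p_i-2}\nabla u_i\cdot\nabla\varphi\,dx+\int_\Omega|u_i|^{p_i-2}u_i\varphi\,dx=\int_{\partial\Omega}g_i(x,u_1,u_2)\varphi\,d\sigma .$$ For $1<r<\infty$ let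 $\lambda_{1,r}$ be the smallest eigenvalue of the Steklov problem $-\Delta_ru=-|u|^{r-2}u$ in $\Omega$, $|\nabla u|^{r-2}\nabla u\cdot\nu=\lambda|u|^{r-2}u$ on $\partial\Omega$ (understood weakly), and let $u_{1,r}$ be the positive eigenfunction for $\lambda_{1,r}$ with $\|u_{1,r}\|_{L^r(\partial\Omega)}=1$. Assume: (H0) For $i=1,2$, $g_i$ is a Carathéodory function with $g_i(x,0,0)=0$ for a.a. $x\in\partial\Omega$; for every bounded set $M\subset\mathbb R^2$ there is $H_i\in L^\infty(\partial\Omega)$ with $|g_i(x,s_1,s_2)|\le H_i(x)$ for a.a. $x\in\partial\Omega$ and all $(s_1,s_2)\in M$; and there are $K_i>0$, $L_i\in\mathbb R$, $\alpha_i\in(0,1]$ such that $$|g_i(x_1,s_1,t_1)-g_i(x_2,s_2,t_2)|\le L_i\left(|x_1-x_2|^{\alpha_i}+|s_1-s_2|^{\alpha_i}+|t_1-t_2|^{\alpha_i}\right)$$ for all $(x_1,s_1,t_1),(x_2,s_2,t_2)\in\partial\Omega\times[-K_i,K_i]^2$. (H1) There are constants $k_i>0$ and $d_i<0$, $i=1,2$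 (fixed from now on), such that for a.a. $x\in\partial\Omega$: $g_1(x,k_1,s_2)\le0$ for all $s_2\in[0,k_2]$; $g_1(x,d_1,s_2)\ge0$ for all $s_2\in[d_2,0]$; $g_2(x,s_1,k_2)\le0$ for all $s_1\in[0,k_1]$; $g_2(x,s_1,d_2)\ge0$ for all $s_1\in[d_1,0]$. (H2) There are constants $c_i>\lambda_{1,p_i}$, $i=1,2$, such that, uniformly for a.a. $x\in\partial\Omega$, $\liminf_{s_1\to0^+}g_1(x,s_1,s_2)/s_1^{p_1-1}\ge c_1$ uniformly in $s_2\in(0,k_2]$; $\liminf_{s_1\to0^-}g_1(x,s_1,s_2)/(|s_1|^{p_1-2}s_1)\ge c_1$ uniformly in $s_2\in[d_2,0)$; $\liminf_{s_2\to0^+}g_2(x,s_1,s_2)/s_2^{p_2-1}\ge c_2$ uniformly in $s_1\in(0,k_1]$; $\liminf_{s_2\to0^-}g_2(x,s_1,s_2)/(|s_2|^{p_2-2}s_2)\ge c_2$ uniformly in $s_1\in[d_1,0)$. For functions $a\le b$ a.e. on $\Omega$ let $[a,b]$ denote the set of $u$ in the relevant space $W^{1,p_i}(\Omega)$ with $a\le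 u\le b$ a.e. in $\Omega$; pairs are ordered componentwise, a.e. in $\Omega$. Let $\varepsilon>0$. (i) For every solution $(u_1,u_2)$ of (P) in $R=[\varepsilon u_{1,p_1},k_1]\times[\varepsilon u_{1,p_2},k_2]$ there is a minimal solution $(u_1^\varepsilon,u_2^\varepsilon)$ of (P) in $R$, that is, a solution of (P) in $R$ such that every solution $(h_1,h_2)\in R$ with $h_i\le u_i^\varepsilon$ for $i=1,2$ equals it, which satisfies $u_i^\varepsilon\le u_i$ for $i=1,2$. (ii) For every solution $(v_1,v_2)$ of (P) in $R'=[d_1,-\varepsilon u_{1,p_1}]\times[d_2,-\varepsilon u_{1,p_2}]$ there is a maximal solution $(v_1^\varepsilon,v_2^\varepsilon)$ of (P) in $R'$, that is, a solution of (P) in $R'$ such that every solution $(h_1,h_2)\in R'$ with $h_i\ge v_i^\varepsilon$ for $i=1,2$ equals it, which satisfies $v_i^\varepsilon\ge v_i$ for $i=1,2$. -/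

import Mathlib

open MeasureTheory Filter Topology Set
open scoped ENNReal ContDiff RealInnerProductSpace

noncomputable section

/-- Euclidean space of dimension `N`. -/
abbrev RSpace (N : ℕ) := EuclideanSpace ℝ (Fin N)

/-- `Ω` has a `C²` boundary: near each boundary point and after a rotation of the axes, `Ω` is the
region above the graph of a `C²` function. The unit vector `e` is the direction of the vertical
axis and `x - ⟪e, x⟫ • e` is the horizontal part of `x`. -/
def HasC2Boundary {N : ℕ} (Ω : Set (RSpace N)) : Prop :=
  ∀ z ∈ frontier Ω, ∃ (r : ℝ) (e : RSpace N) (γ : RSpace N → ℝ),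
    0 < r ∧ ‖e‖ = 1 ∧ ContDiff ℝ 2 γ ∧
    ∀ x ∈ Metric.ball z r, (x ∈ Ω ↔ γ (x - ⟪e, x⟫ • e) < ⟪e, x⟫)

/-- A bounded domain (open, connected, nonempty) with `C²` boundary. -/
structure IsBoundedC2Domain {N : ℕ} (Ω : Set (RSpace N)) : Prop where
  isOpen : IsOpen Ω
  isConnected : IsConnected Ω
  isBounded : Bornology.IsBounded Ω
  boundary : HasC2Boundary Ω

/-- The surface measure on `∂Ω`: the `(N - 1)`-dimensional Hausdorff measure (normalized so as to
agree with Lebesgue measure in dimension `N - 1`), restricted to `∂Ω`. It is used for `1 ≤ N`. -/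
def surfaceMeasure {N : ℕ} (Ω : Set (RSpace N)) : Measure (RSpace N) :=
  (Measure.euclideanHausdorffMeasure (N - 1)).restrict (frontier Ω)

/-- `G` is the weak gradient of `u` on `Ω`, for (locally integrable) `u` and `G`. -/
def IsWeakGradient {N : ℕ} (Ω : Set (RSpace N)) (u : RSpace N → ℝ)
    (G : RSpace N → RSpace N) : Prop :=
  ∀ φ : RSpace N → ℝ, ContDiff ℝ ∞ φ → HasCompactSupport φ → tsupport φ ⊆ Ω →
    ∫ x in Ω, u x • gradient φ x = - ∫ x in Ω, φ x • G x

/-- The Sobolev space `W^{1,p}(Ω)`: functions in `L^p(Ω)` with a weak gradient in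
`L^p(Ω; ℝ^N)`. (For open `Ω` the gradient is determined by the function.) -/
structure SobolevW {N : ℕ} (Ω : Set (RSpace N)) (p : ℝ) where
  val : Lp ℝ (ENNReal.ofReal p) (volume.restrict Ω)
  grad : Lp (RSpace N) (ENNReal.ofReal p) (volume.restrict Ω)
  isWeakGradient : IsWeakGradient Ω val grad

/-- The order of `W^{1,p}(Ω)`: `u ≤ v` if and only if `u(x) ≤ v(x)` for a.e. `x ∈ Ω`. -/
instance {N : ℕ} (Ω : Set (RSpace N)) (p : ℝ) : Preorder (SobolevW Ω p) :=
  Preorder.lift SobolevW.val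

theorem SobolevW.le_iff {N : ℕ} {Ω : Set (RSpace N)} {p : ℝ} (u v : SobolevW Ω p) :
    u ≤ v ↔ ∀ᵐ x ∂(volume.restrict Ω), u.val x ≤ v.val x :=
  (Lp.coeFn_le u.val v.val).symm

/-- `w ∈ L^p(∂Ω)` is the boundary trace of `u ∈ W^{1,p}(Ω)`: there are `C¹` functions that converge
to `u` in `W^{1,p}(Ω)` and whose restrictions to `∂Ω` converge to `w` in `L^p(∂Ω)`. On a bounded
domain with `C²` boundary each `u` has exactly one trace. -/
def IsTrace {N : ℕ} {Ω : Set (RSpace N)} {p : ℝ} (u : SobolevW Ω p)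
    (w : Lp ℝ (ENNReal.ofReal p) (surfaceMeasure Ω)) : Prop :=
  ∃ f : ℕ → RSpace N → ℝ, (∀ n, ContDiff ℝ 1 (f n)) ∧
    Tendsto (fun n ↦ eLpNorm (fun x ↦ f n x - u.val x) (ENNReal.ofReal p) (volume.restrict Ω))
      atTop (𝓝 0) ∧
    Tendsto (fun n ↦ eLpNorm (fun x ↦ gradient (f n) x - u.grad x) (ENNReal.ofReal p)
      (volume.restrict Ω)) atTop (𝓝 0) ∧
    Tendsto (fun n ↦ eLpNorm (fun x ↦ f n x - w x) (ENNReal.ofReal p) (surfaceMeasure Ω))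
      atTop (𝓝 0)

/-- `u ∈ W^{1,p}(Ω)` is a weak solution of `-Δ_p u = -|u|^{p-2} u` in `Ω`,
`|∇u|^{p-2} ∇u · ν = b` on `∂Ω`; here `ψ` stands for the trace of the test function `φ`. All the
integrals are required to exist. -/
def SolvesBoundaryProblem {N : ℕ} {Ω : Set (RSpace N)} {p : ℝ} (u : SobolevW Ω p)
    (b : RSpace N → ℝ) : Prop :=
  ∀ (φ : SobolevW Ω p) (ψ : Lp ℝ (ENNReal.ofReal p) (surfaceMeasure Ω)), IsTrace φ ψ →
    Integrable (fun x ↦ ‖u.grad x‖ ^ (p - 2) * ⟪u.grad x, φ.grad x⟫) (volume.restrict Ω) ∧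
    Integrable (fun x ↦ |u.val x| ^ (p - 2) * u.val x * φ.val x) (volume.restrict Ω) ∧
    Integrable (fun x ↦ b x * ψ x) (surfaceMeasure Ω) ∧
    (∫ x in Ω, ‖u.grad x‖ ^ (p - 2) * ⟪u.grad x, φ.grad x⟫)
      + (∫ x in Ω, |u.val x| ^ (p - 2) * u.val x * φ.val x)
      = ∫ x, b x * ψ x ∂(surfaceMeasure Ω)

/-- Weak solutions `(u₁, u₂) ∈ W^{1,p₁}(Ω) × W^{1,p₂}(Ω)` of the system
`-Δ_{p_i} u_i = -|u_i|^{p_i-2} u_i` in `Ω`, `|∇u_i|^{p_i-2} ∇u_i · ν = g_i(x, u₁, u₂)` on `∂Ω`. -/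
def IsWeakSolution {N : ℕ} {Ω : Set (RSpace N)} {p₁ p₂ : ℝ} (g₁ g₂ : RSpace N → ℝ → ℝ → ℝ)
    (u : SobolevW Ω p₁ × SobolevW Ω p₂) : Prop :=
  ∃ (w₁ : Lp ℝ (ENNReal.ofReal p₁) (surfaceMeasure Ω))
    (w₂ : Lp ℝ (ENNReal.ofReal p₂) (surfaceMeasure Ω)),
    IsTrace u.1 w₁ ∧ IsTrace u.2 w₂ ∧
    SolvesBoundaryProblem u.1 (fun x ↦ g₁ x (w₁ x) (w₂ x)) ∧
    SolvesBoundaryProblem u.2 (fun x ↦ g₂ x (w₁ x) (w₂ x))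

/-- `u` is an eigenfunction for the eigenvalue `μ` of the Steklov problem
`-Δ_p u = -|u|^{p-2} u` in `Ω`, `|∇u|^{p-2} ∇u · ν = μ |u|^{p-2} u` on `∂Ω`. -/
def IsSteklovEigenfunction {N : ℕ} {Ω : Set (RSpace N)} {p : ℝ} (μ : ℝ) (u : SobolevW Ω p) :
    Prop :=
  u.val ≠ 0 ∧ ∃ w : Lp ℝ (ENNReal.ofReal p) (surfaceMeasure Ω), IsTrace u w ∧
    SolvesBoundaryProblem u (fun x ↦ μ * (|w x| ^ (p - 2) * w x))

/-- The first Steklov eigenvalue `λ_{1,p}`: the smallest eigenvalue. -/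
def steklovFirstEigenvalue {N : ℕ} (Ω : Set (RSpace N)) (p : ℝ) : ℝ :=
  sInf {μ : ℝ | ∃ u : SobolevW Ω p, IsSteklovEigenfunction μ u}

/-- `e` is the positive first Steklov eigenfunction `u_{1,p}` normalized in `L^p(∂Ω)`. -/
def IsNormalizedFirstEigenfunction {N : ℕ} {Ω : Set (RSpace N)} {p : ℝ} (e : SobolevW Ω p) :
    Prop :=
  IsSteklovEigenfunction (steklovFirstEigenvalue Ω p) e ∧
  (∀ᵐ x ∂(volume.restrict Ω), 0 < e.val x) ∧
  ∃ w : Lp ℝ (ENNReal.ofReal p) (surfaceMeasure Ω), IsTrace e w ∧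
    eLpNorm w (ENNReal.ofReal p) (surfaceMeasure Ω) = 1

/-- The order interval `[a, b] = {u ∈ W^{1,p}(Ω) : a ≤ u ≤ b a.e. in Ω}`. -/
def sobolevInterval {N : ℕ} (Ω : Set (RSpace N)) (p : ℝ) (a b : RSpace N → ℝ) :
    Set (SobolevW Ω p) :=
  {u | ∀ᵐ x ∂(volume.restrict Ω), a x ≤ u.val x ∧ u.val x ≤ b x}

/-- Hypothesis (H0) for one of the functions `g₁`, `g₂`: a Carathéodory function on `∂Ω × ℝ × ℝ`
which vanishes at `(x, 0, 0)`, is bounded on bounded sets, and is locally Hölder continuous. -/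
structure HypothesisH0 {N : ℕ} (Ω : Set (RSpace N)) (g : RSpace N → ℝ → ℝ → ℝ) : Prop where
  measurable : ∀ s t : ℝ, AEStronglyMeasurable (fun x ↦ g x s t) (surfaceMeasure Ω)
  continuous : ∀ᵐ x ∂(surfaceMeasure Ω), Continuous (fun q : ℝ × ℝ ↦ g x q.1 q.2)
  zero : ∀ᵐ x ∂(surfaceMeasure Ω), g x 0 0 = 0
  bounded : ∀ M : Set (ℝ × ℝ), Bornology.IsBounded M →
    ∃ H : RSpace N → ℝ, MemLp H ∞ (surfaceMeasure Ω) ∧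
      ∀ᵐ x ∂(surfaceMeasure Ω), ∀ q ∈ M, |g x q.1 q.2| ≤ H x
  holder : ∃ K L α : ℝ, 0 < K ∧ 0 < α ∧ α ≤ 1 ∧
    ∀ x₁ ∈ frontier Ω, ∀ x₂ ∈ frontier Ω, ∀ s₁ ∈ Icc (-K) K, ∀ t₁ ∈ Icc (-K) K,
      ∀ s₂ ∈ Icc (-K) K, ∀ t₂ ∈ Icc (-K) K,
        |g x₁ s₁ t₁ - g x₂ s₂ t₂| ≤ L * (‖x₁ - x₂‖ ^ α + |s₁ - s₂| ^ α + |t₁ - t₂| ^ α)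

/-- Hypothesis (H1), with the constants `k_i > 0` and `d_i < 0`. -/
structure HypothesisH1 {N : ℕ} (Ω : Set (RSpace N)) (g₁ g₂ : RSpace N → ℝ → ℝ → ℝ)
    (k₁ k₂ d₁ d₂ : ℝ) : Prop where
  k₁_pos : 0 < k₁
  k₂_pos : 0 < k₂
  d₁_neg : d₁ < 0
  d₂_neg : d₂ < 0
  g₁_k : ∀ᵐ x ∂(surfaceMeasure Ω), ∀ s₂ ∈ Icc 0 k₂, g₁ x k₁ s₂ ≤ 0
  g₁_d : ∀ᵐ x ∂(surfaceMeasure Ω), ∀ s₂ ∈ Icc d₂ 0, 0 ≤ g₁ x d₁ s₂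
  g₂_k : ∀ᵐ x ∂(surfaceMeasure Ω), ∀ s₁ ∈ Icc 0 k₁, g₂ x s₁ k₂ ≤ 0
  g₂_d : ∀ᵐ x ∂(surfaceMeasure Ω), ∀ s₁ ∈ Icc d₁ 0, 0 ≤ g₂ x s₁ d₂

/-- Hypothesis (H2), with the constants `c_i > λ_{1,p_i}`; "`liminf ≥ c` uniformly" is spelled
out. -/
def HypothesisH2 {N : ℕ} (Ω : Set (RSpace N)) (p₁ p₂ : ℝ) (g₁ g₂ : RSpace N → ℝ → ℝ → ℝ)
    (k₁ k₂ d₁ d₂ : ℝ) : Prop :=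
  ∃ c₁ c₂ : ℝ, steklovFirstEigenvalue Ω p₁ < c₁ ∧ steklovFirstEigenvalue Ω p₂ < c₂ ∧
    (∀ η > 0, ∃ δ > 0, ∀ᵐ x ∂(surfaceMeasure Ω), ∀ s₂ ∈ Ioc 0 k₂, ∀ s₁ ∈ Ioo 0 δ,
      c₁ - η ≤ g₁ x s₁ s₂ / s₁ ^ (p₁ - 1)) ∧
    (∀ η > 0, ∃ δ > 0, ∀ᵐ x ∂(surfaceMeasure Ω), ∀ s₂ ∈ Ico d₂ 0, ∀ s₁ ∈ Ioo (-δ) 0,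
      c₁ - η ≤ g₁ x s₁ s₂ / (|s₁| ^ (p₁ - 2) * s₁)) ∧
    (∀ η > 0, ∃ δ > 0, ∀ᵐ x ∂(surfaceMeasure Ω), ∀ s₁ ∈ Ioc 0 k₁, ∀ s₂ ∈ Ioo 0 δ,
      c₂ - η ≤ g₂ x s₁ s₂ / s₂ ^ (p₂ - 1)) ∧
    (∀ η > 0, ∃ δ > 0, ∀ᵐ x ∂(surfaceMeasure Ω), ∀ s₁ ∈ Ico d₁ 0, ∀ s₂ ∈ Ioo (-δ) 0,
      c₂ - η ≤ g₂ x s₁ s₂ / (|s₂| ^ (p₂ - 2) * s₂))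

end

/-!
The set of solutions in a bounded order rectangle is closed under limits of decreasing and of
increasing sequences, and this gives minimal and maximal solutions without Zorn's lemma: the
functional `(u₁, u₂) ↦ ∫ u₁ + ∫ u₂` is bounded and strictly monotone on the rectangle, so the
ordering principle of Brezis and Browder (`exists_minimal_of_antitone_seq`) applies.

The point is therefore the stability of solutions under bounded monotone limits
(`exists_isWeakSolution_of_monotone`). The trace preserves the order and bounds (`IsTrace.mono`,
`IsTrace.ae_le_const`, `IsTrace.ae_const_le`), so the traces of a monotone sequence of solutions are
monotone and bounded, and converge in `L^p(∂Ω)` by dominated convergence; no compactness of the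
trace is involved. Testing the difference of the equations for `u_m` and `u_n` with `u_m - u_n` then
shows that the gradients are Cauchy in `L^p(Ω)`, because `a ↦ |a|^{p-2} a` is strictly monotone, in
the quantitative form `exists_norm_sub_rpow_le` (`cauchySeq_grad_of_solves`). Hence every term of
the weak formulation converges (`exists_solvesBoundaryProblem_of_tendsto`).

That traces preserve the order rests on the `L¹` trace inequality (`exists_trace_bound`), obtained
from the fundamental theorem of calculus along segments transversal to the boundary. Applied to
`(f⁺)^p` it shows that `f_n⁺` tends to `0` in `L^p(∂Ω)` when it does so in `L^p(Ω)` with bounded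
gradients (`trace_nonpos`).
-/

/-! ### The trace inequality and finiteness of the surface measure -/

/-- Tonelli's theorem for the splitting of space into the hyperplane `eᗮ` and the line spanned by
`e`. By uniqueness of Haar measure it holds up to a finite constant, which is all that a trace
inequality needs. -/
theorem exists_lintegral_orthogonal_prod_eq {N : ℕ} {e : RSpace N} (he : ‖e‖ = 1) :
    ∃ C : ℝ≥0∞, C ≠ ⊤ ∧ ∀ k : RSpace N → ℝ≥0∞, Measurable k →
      ∫⁻ y : (ℝ ∙ e)ᗮ, ∫⁻ s : ℝ, k (y + s • e) = C * ∫⁻ x, k x := by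
  have hY : ∀ y : (ℝ ∙ e)ᗮ, ⟪e, (y : RSpace N)⟫ = 0 := fun y ↦
    (Submodule.mem_orthogonal_singleton_iff_inner_right.1 y.2)
  let T : ((ℝ ∙ e)ᗮ × ℝ) →ₗ[ℝ] RSpace N :=
    { toFun := fun q ↦ q.1 + q.2 • e
      map_add' := fun a b ↦ by simp [add_smul]; abel
      map_smul' := fun c a ↦ by simp [mul_smul] }
  have hTi : Function.Injective T := by
    refine (injective_iff_map_eq_zero T).2 fun q hq ↦ ?_
    have h1 : (q.1 : RSpace N) + q.2 • e = 0 := hq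
    have h2 : q.2 = 0 := by
      have := congrArg (fun x ↦ ⟪e, x⟫) h1
      simpa [inner_add_right, inner_smul_right, hY, he] using this
    refine Prod.ext (Subtype.ext ?_) h2
    simpa [h2] using h1
  have hTs : Function.Surjective T := by
    intro x
    refine ⟨(⟨x - ⟪e, x⟫ • e, ?_⟩, ⟪e, x⟫), ?_⟩
    · rw [Submodule.mem_orthogonal_singleton_iff_inner_right]
      simp [inner_sub_right, inner_smul_right, he]
    · simp [T]
  let T' : ((ℝ ∙ e)ᗮ × ℝ) ≃L[ℝ] RSpace N :=
    (LinearEquiv.ofBijective T ⟨hTi, hTs⟩).toContinuousLinearEquiv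
  let μ : Measure (RSpace N) :=
    ((volume : Measure (ℝ ∙ e)ᗮ).prod (volume : Measure ℝ)).map T'
  have : μ.IsAddHaarMeasure := T'.isAddHaarMeasure_map _
  refine ⟨μ.addHaarScalarFactor volume, ENNReal.coe_ne_top, fun k hk ↦ ?_⟩
  have h1 : μ = μ.addHaarScalarFactor volume • (volume : Measure (RSpace N)) :=
    Measure.isAddLeftInvariant_eq_smul _ _
  have h2 : ∫⁻ x, k x ∂μ = μ.addHaarScalarFactor volume * ∫⁻ x, k x := by
    conv_lhs => rw [h1]
    rw [lintegral_smul_measure]; rfl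
  rw [← h2, lintegral_map hk T'.continuous.measurable, lintegral_prod]
  · rfl
  · exact (hk.comp T'.continuous.measurable).aemeasurable

/-- The value of a function at one end of a segment is bounded by its mean on the segment plus the
integral of the modulus of its derivative. -/
theorem ofReal_le_lintegral_segment {q q' : ℝ → ℝ} (hq : ∀ t, HasDerivAt q (q' t) t)
    (hq' : Continuous q') {δ : ℝ} (hδ : 0 < δ) :
    ENNReal.ofReal (q 0) ≤ (ENNReal.ofReal δ)⁻¹ * (∫⁻ t in Ioc 0 δ, ENNReal.ofReal (q t))
      + ∫⁻ t in Ioc 0 δ, ‖q' t‖ₑ := by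
  have hpt : ∀ t ∈ Ioc 0 δ, ENNReal.ofReal (q 0) ≤
      ENNReal.ofReal (q t) + ∫⁻ t in Ioc 0 δ, ‖q' t‖ₑ := by
    intro t ht
    have h1 : ∫ s in (0 : ℝ)..t, q' s = q t - q 0 :=
      intervalIntegral.integral_eq_sub_of_hasDerivAt (fun x _ ↦ hq x)
        (hq'.intervalIntegrable _ _)
    have h2 : ‖∫ s in (0 : ℝ)..t, q' s‖ₑ ≤ ∫⁻ t in Ioc 0 δ, ‖q' t‖ₑ := by
      rw [intervalIntegral.integral_of_le ht.1.le]
      exact (enorm_integral_le_lintegral_enorm _).trans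
        (lintegral_mono_set (Ioc_subset_Ioc_right ht.2))
    calc ENNReal.ofReal (q 0) ≤ ENNReal.ofReal (q t + |q t - q 0|) := by
          apply ENNReal.ofReal_le_ofReal
          have := neg_abs_le (q t - q 0)
          linarith
      _ ≤ ENNReal.ofReal (q t) + ENNReal.ofReal |q t - q 0| := ENNReal.ofReal_add_le
      _ ≤ _ := by
          gcongr
          rw [← h1, ← Real.norm_eq_abs, ofReal_norm]
          exact h2
  have h3 : ENNReal.ofReal δ * ENNReal.ofReal (q 0) ≤
      (∫⁻ t in Ioc 0 δ, ENNReal.ofReal (q t)) +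
        ENNReal.ofReal δ * ∫⁻ t in Ioc 0 δ, ‖q' t‖ₑ := by
    have := setLIntegral_mono' (μ := volume) (measurableSet_Ioc (a := (0 : ℝ)) (b := δ)) hpt
    rw [lintegral_add_right _ measurable_const, setLIntegral_const, setLIntegral_const,
      Real.volume_Ioc, sub_zero] at this
    rwa [mul_comm, mul_comm (ENNReal.ofReal δ)]
  have hδ0 : ENNReal.ofReal δ ≠ 0 := by simpa using hδ
  calc ENNReal.ofReal (q 0)
      = (ENNReal.ofReal δ)⁻¹ * (ENNReal.ofReal δ * ENNReal.ofReal (q 0)) := by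
        rw [← mul_assoc, ENNReal.inv_mul_cancel hδ0 ENNReal.ofReal_ne_top, one_mul]
    _ ≤ (ENNReal.ofReal δ)⁻¹ * ((∫⁻ t in Ioc 0 δ, ENNReal.ofReal (q t)) +
          ENNReal.ofReal δ * ∫⁻ t in Ioc 0 δ, ‖q' t‖ₑ) := by gcongr
    _ = _ := by
        rw [mul_add, ← mul_assoc (ENNReal.ofReal δ)⁻¹ (ENNReal.ofReal δ),
          ENNReal.inv_mul_cancel hδ0 ENNReal.ofReal_ne_top, one_mul]

theorem LipschitzOnWith.euclideanHausdorffMeasure_image_le {X Y : Type*}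
    [EMetricSpace X] [MeasurableSpace X] [BorelSpace X]
    [EMetricSpace Y] [MeasurableSpace Y] [BorelSpace Y] {K : NNReal} {f : X → Y} {s : Set X}
    (h : LipschitzOnWith K f s) (d : ℕ) :
    Measure.euclideanHausdorffMeasure d (f '' s) ≤
      (K : ℝ≥0∞) ^ d * Measure.euclideanHausdorffMeasure d s := by
  simp only [Measure.euclideanHausdorffMeasure_def, Measure.smul_apply, ENNReal.smul_def,
    smul_eq_mul]
  have := h.hausdorffMeasure_image_le (d := d) (by positivity)
  rw [ENNReal.rpow_natCast] at this
  rw [mul_left_comm]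
  gcongr

/-- Where an open set is the region above a continuous graph, its frontier lies on that graph. -/
theorem eq_of_mem_frontier_of_graph {N : ℕ} {Ω : Set (RSpace N)} (hΩ : IsOpen Ω)
    {z : RSpace N} {r : ℝ} {e : RSpace N} {γ : RSpace N → ℝ} (hγ : Continuous γ)
    (h : ∀ x ∈ Metric.ball z r, (x ∈ Ω ↔ γ (x - ⟪e, x⟫ • e) < ⟪e, x⟫))
    {x : RSpace N} (hx : x ∈ frontier Ω) (hxr : x ∈ Metric.ball z r) :
    γ (x - ⟪e, x⟫ • e) = ⟪e, x⟫ := by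
  have hx' : x ∉ Ω := by rw [hΩ.frontier_eq] at hx; exact hx.2
  have h1 : ⟪e, x⟫ ≤ γ (x - ⟪e, x⟫ • e) := not_lt.1 fun hlt ↦ hx' ((h x hxr).2 hlt)
  refine le_antisymm (not_lt.1 fun hlt ↦ ?_) h1
  have hopen : IsOpen {y : RSpace N | ⟪e, y⟫ < γ (y - ⟪e, y⟫ • e)} :=
    isOpen_lt (by fun_prop) (by fun_prop)
  obtain ⟨y, ⟨hy1, hy2⟩, hy3⟩ := mem_closure_iff.1 (frontier_subset_closure hx) _
    (hopen.inter Metric.isOpen_ball) ⟨hlt, hxr⟩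
  exact lt_asymm ((h y hy2).1 hy3) hy1

/-- The trace inequality on a boundary patch. The patch is a Lipschitz image of a piece of the
hyperplane `eᗮ`, which bounds its Hausdorff measure; each value on the patch is bounded by
integrals along the vertical segment above it, and these segments fill a part of `Ω`. -/
theorem exists_local_trace_bound {N : ℕ} (hN : 1 ≤ N) {Ω : Set (RSpace N)} (hΩ : IsOpen Ω)
    (hb : HasC2Boundary Ω) {z : RSpace N} (hz : z ∈ frontier Ω) :
    ∃ ρ > 0, ∃ C : ℝ≥0∞, C ≠ ⊤ ∧ ∀ h : RSpace N → ℝ, ContDiff ℝ 1 h →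
      ∫⁻ x in frontier Ω ∩ Metric.ball z ρ, ENNReal.ofReal (h x)
        ∂(Measure.euclideanHausdorffMeasure (N - 1)) ≤
      C * ∫⁻ x in Ω, (ENNReal.ofReal (h x) + ‖gradient h x‖ₑ) := by
  obtain ⟨r, e, γ, hr, he, hγ, hgraph⟩ := hb z hz
  have hY : ∀ y : (ℝ ∙ e)ᗮ, ⟪e, (y : RSpace N)⟫ = 0 := fun y ↦
    (Submodule.mem_orthogonal_singleton_iff_inner_right.1 y.2)
  have hfin : Module.finrank ℝ (ℝ ∙ e)ᗮ = N - 1 := by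
    have h1 := (ℝ ∙ e).finrank_add_finrank_orthogonal
    have he0 : e ≠ 0 := by rintro rfl; simp at he
    rw [finrank_span_singleton he0, finrank_euclideanSpace_fin] at h1
    omega
  obtain ⟨C₀, hC₀, hfub⟩ := exists_lintegral_orthogonal_prod_eq he
  -- The graph map and the part of the hyperplane that parametrizes the boundary patch.
  set Φ : (ℝ ∙ e)ᗮ → RSpace N := fun y ↦ y + γ y • e with hΦ
  have hΦc : ContDiff ℝ 1 Φ := by
    have h2 : ContDiff ℝ 1 γ := hγ.of_le (by norm_num)
    have h3 : ContDiff ℝ 1 (fun y : (ℝ ∙ e)ᗮ ↦ (y : RSpace N)) :=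
      (ℝ ∙ e)ᗮ.subtypeL.contDiff
    exact h3.add ((h2.comp h3).smul contDiff_const)
  set S : Set (RSpace N) := frontier Ω ∩ Metric.ball z (r / 2) with hS
  have hSm : MeasurableSet S := isClosed_frontier.measurableSet.inter measurableSet_ball
  set T : Set (ℝ ∙ e)ᗮ := Φ ⁻¹' S with hT
  have hTm : MeasurableSet T := hΦc.continuous.measurable hSm
  have hST : S ⊆ Φ '' T := by
    intro x hx
    have h1 := eq_of_mem_frontier_of_graph hΩ hγ.continuous hgraph hx.1
      (Metric.ball_subset_ball (by linarith) hx.2)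
    have h2 : Φ ⟨x - ⟪e, x⟫ • e, by
        rw [Submodule.mem_orthogonal_singleton_iff_inner_right]
        simp [inner_sub_right, inner_smul_right, he]⟩ = x := by
      simp [hΦ, h1]
    exact ⟨_, by rw [hT, mem_preimage, h2]; exact hx, h2⟩
  have hTb : T ⊆ Metric.closedBall 0 (‖z‖ + r) := by
    intro y hy
    have h1 : ‖Φ y‖ ≤ ‖z‖ + r := by
      have h2 : dist (Φ y) z < r / 2 := hy.2
      rw [dist_eq_norm] at h2
      have := norm_le_norm_add_norm_sub' (Φ y) z
      linarith
    have h3 : ‖(y : RSpace N)‖ * ‖(y : RSpace N)‖ ≤ ‖Φ y‖ * ‖Φ y‖ := by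
      have := norm_add_sq_eq_norm_sq_add_norm_sq_of_inner_eq_zero (y : RSpace N) (γ y • e)
        (by rw [inner_smul_right, real_inner_comm, hY, mul_zero])
      rw [hΦ]
      nlinarith [norm_nonneg (γ y • e)]
    rw [mem_closedBall_zero_iff]
    exact (abs_le_of_sq_le_sq' (by simpa [sq] using h3) (norm_nonneg _)).2.trans h1
  obtain ⟨K, hK⟩ : ∃ K, LipschitzOnWith K Φ T := by
    obtain ⟨M, hM⟩ := (isCompact_closedBall (0 : (ℝ ∙ e)ᗮ) (‖z‖ + r)).exists_bound_of_continuousOn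
      (hΦc.continuous_fderiv one_ne_zero).continuousOn
    refine ⟨M.toNNReal, LipschitzOnWith.mono ?_ hTb⟩
    refine (convex_closedBall _ _).lipschitzOnWith_of_nnnorm_fderiv_le (𝕜 := ℝ)
      (fun x _ ↦ (hΦc.differentiable one_ne_zero) x) fun x hx ↦ ?_
    exact NNReal.le_toNNReal_of_coe_le (hM x hx)
  have hmeas : (Measure.euclideanHausdorffMeasure (N - 1)).restrict S ≤
      (K : ℝ≥0∞) ^ (N - 1) • (volume.restrict T).map Φ := by
    refine Measure.le_iff.2 fun B hB ↦ ?_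
    rw [Measure.restrict_apply hB, Measure.smul_apply,
      Measure.map_apply hΦc.continuous.measurable hB,
      Measure.restrict_apply (hΦc.continuous.measurable hB), smul_eq_mul,
      ← InnerProductSpace.euclideanHausdorffMeasure_eq_volume, hfin]
    refine (measure_mono ?_).trans ((hK.mono inter_subset_right).euclideanHausdorffMeasure_image_le _)
    rintro x ⟨hxB, hxS⟩
    obtain ⟨y, hy, rfl⟩ := hST hxS
    exact ⟨y, ⟨hxB, hy⟩, rfl⟩
  -- The patch has radius `r / 2`, so segments of length `r / 4` above it stay in the ball of
  -- radius `r` in which `Ω` is described by the graph.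
  set δ := r / 4 with hδ
  have hδ0 : 0 < δ := by positivity
  have hin : ∀ y ∈ T, ∀ t ∈ Ioc 0 δ, Φ y + t • e ∈ Ω := by
    intro y hy t ht
    refine (hgraph _ ?_).2 ?_
    · have h2 : dist (Φ y) z < r / 2 := hy.2
      rw [Metric.mem_ball, dist_eq_norm] at *
      calc ‖Φ y + t • e - z‖ = ‖(Φ y - z) + t • e‖ := by congr 1; abel
        _ ≤ ‖Φ y - z‖ + ‖t • e‖ := norm_add_le _ _
        _ < r / 2 + r / 4 := by
            rw [norm_smul, he, mul_one, Real.norm_of_nonneg ht.1.le]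
            linarith [ht.2]
        _ < r := by linarith
    · have h1 : ⟪e, Φ y + t • e⟫ = γ y + t := by
        simp [hΦ, inner_add_right, inner_smul_right, he, hY]
      have h2 : Φ y + t • e - (γ y + t) • e = y := by
        simp only [hΦ, add_smul]; abel
      rw [h1, h2]
      linarith [ht.1]
  -- Integrals along the vertical segments above the patch are integrals over `Ω`.
  have hseg : ∀ k : RSpace N → ℝ≥0∞, Measurable k →
      ∫⁻ y in T, ∫⁻ t in Ioc 0 δ, k (Φ y + t • e) ≤ C₀ * ∫⁻ x in Ω, k x := by
    intro k hk
    rw [← lintegral_indicator hΩ.measurableSet, ← hfub _ (hk.indicator hΩ.measurableSet),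
      ← lintegral_indicator hTm]
    refine lintegral_mono fun y ↦ ?_
    by_cases hy : y ∈ T
    · rw [indicator_of_mem hy, ← lintegral_add_left_eq_self (μ := volume)
        (fun s : ℝ ↦ Ω.indicator k (y + s • e)) (γ y), ← lintegral_indicator measurableSet_Ioc]
      refine lintegral_mono fun t ↦ ?_
      by_cases ht : t ∈ Ioc 0 δ
      · have h1 := hin y hy t ht
        have h2 : (y : RSpace N) + (γ y + t) • e = Φ y + t • e := by
          simp only [hΦ, add_smul]; abel
        simp only [indicator_of_mem ht, h2, indicator_of_mem h1, le_refl]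
      · simp [indicator_of_notMem ht]
    · simp [indicator_of_notMem hy]
  refine ⟨r / 2, by positivity,
    (K : ℝ≥0∞) ^ (N - 1) * (((ENNReal.ofReal δ)⁻¹ + 1) * C₀), ?_, fun h hh ↦ ?_⟩
  · have : (ENNReal.ofReal δ)⁻¹ ≠ ⊤ := by simpa using hδ0
    finiteness
  have hgc : Continuous (gradient h) :=
    (InnerProductSpace.toDual ℝ (RSpace N)).symm.continuous.comp (hh.continuous_fderiv one_ne_zero)
  have hm1 : Measurable fun x ↦ ENNReal.ofReal (h x) :=
    ENNReal.measurable_ofReal.comp hh.continuous.measurable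
  have hm2 : Measurable fun x ↦ ‖gradient h x‖ₑ := hgc.measurable.enorm
  have hpt : ∀ y, ENNReal.ofReal (h (Φ y)) ≤
      (ENNReal.ofReal δ)⁻¹ * (∫⁻ t in Ioc 0 δ, ENNReal.ofReal (h (Φ y + t • e))) +
        ∫⁻ t in Ioc 0 δ, ‖gradient h (Φ y + t • e)‖ₑ := by
    intro y
    have hq : ∀ t : ℝ, HasDerivAt (fun t : ℝ ↦ h (Φ y + t • e))
        ⟪gradient h (Φ y + t • e), e⟫ t := by
      intro t
      have h2 : HasDerivAt (fun t : ℝ ↦ Φ y + t • e) e t := by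
        simpa using ((hasDerivAt_id t).smul_const e).const_add (Φ y)
      have h1 := ((hh.differentiable one_ne_zero) (Φ y + t • e)).hasFDerivAt.comp_hasDerivAt t h2
      have h4 : ⟪gradient h (Φ y + t • e), e⟫ = fderiv ℝ h (Φ y + t • e) e := by
        rw [gradient, InnerProductSpace.toDual_symm_apply]
      rw [h4]
      exact h1
    have h3 := ofReal_le_lintegral_segment hq
      ((hgc.comp (by fun_prop)).inner continuous_const) hδ0
    simp only [zero_smul, add_zero] at h3
    refine h3.trans (add_le_add le_rfl (lintegral_mono fun t ↦ ?_))
    rw [← ofReal_norm, ← ofReal_norm]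
    refine ENNReal.ofReal_le_ofReal ((norm_inner_le_norm _ _).trans ?_)
    rw [he, mul_one]
  have hmm : ∀ k : RSpace N → ℝ≥0∞, Measurable k →
      Measurable fun y : (ℝ ∙ e)ᗮ ↦ ∫⁻ t in Ioc 0 δ, k (Φ y + t • e) := by
    intro k hk
    refine Measurable.lintegral_prod_right' (f := fun q : (ℝ ∙ e)ᗮ × ℝ ↦ k (Φ q.1 + q.2 • e)) ?_
    have := hΦc.continuous
    exact hk.comp (Continuous.measurable (by fun_prop))
  calc ∫⁻ x in S, ENNReal.ofReal (h x) ∂(Measure.euclideanHausdorffMeasure (N - 1))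
      ≤ ∫⁻ x, ENNReal.ofReal (h x) ∂((K : ℝ≥0∞) ^ (N - 1) • (volume.restrict T).map Φ) :=
        lintegral_mono' hmeas le_rfl
    _ = (K : ℝ≥0∞) ^ (N - 1) * ∫⁻ y in T, ENNReal.ofReal (h (Φ y)) := by
        rw [lintegral_smul_measure, lintegral_map hm1 hΦc.continuous.measurable, smul_eq_mul]
    _ ≤ (K : ℝ≥0∞) ^ (N - 1) * ∫⁻ y in T,
          ((ENNReal.ofReal δ)⁻¹ * (∫⁻ t in Ioc 0 δ, ENNReal.ofReal (h (Φ y + t • e))) +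
          ∫⁻ t in Ioc 0 δ, ‖gradient h (Φ y + t • e)‖ₑ) := by
        gcongr with y; exact hpt y
    _ = (K : ℝ≥0∞) ^ (N - 1) * ((ENNReal.ofReal δ)⁻¹ *
          (∫⁻ y in T, ∫⁻ t in Ioc 0 δ, ENNReal.ofReal (h (Φ y + t • e))) +
          ∫⁻ y in T, ∫⁻ t in Ioc 0 δ, ‖gradient h (Φ y + t • e)‖ₑ) := by
        rw [lintegral_add_right _ (hmm _ hm2), lintegral_const_mul _ (hmm _ hm1)]
    _ ≤ (K : ℝ≥0∞) ^ (N - 1) * ((ENNReal.ofReal δ)⁻¹ *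
          (C₀ * ∫⁻ x in Ω, ENNReal.ofReal (h x)) + C₀ * ∫⁻ x in Ω, ‖gradient h x‖ₑ) := by
        gcongr
        · exact hseg _ hm1
        · exact hseg _ hm2
    _ ≤ (K : ℝ≥0∞) ^ (N - 1) * (((ENNReal.ofReal δ)⁻¹ + 1) *
          (C₀ * ∫⁻ x in Ω, ENNReal.ofReal (h x)) +
          ((ENNReal.ofReal δ)⁻¹ + 1) * (C₀ * ∫⁻ x in Ω, ‖gradient h x‖ₑ)) := by
        refine mul_le_mul_right (add_le_add (mul_le_mul_left le_self_add _) ?_) _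
        exact le_mul_of_one_le_left' le_add_self
    _ = _ := by
        rw [lintegral_add_right _ hm2]; ring

/-- The trace inequality in `L¹` for the positive part of a `C¹` function. -/
theorem exists_trace_bound {N : ℕ} (hN : 1 ≤ N) {Ω : Set (RSpace N)} (hΩ : IsBoundedC2Domain Ω) :
    ∃ C : ℝ≥0∞, C ≠ ⊤ ∧ ∀ h : RSpace N → ℝ, ContDiff ℝ 1 h →
      ∫⁻ x, ENNReal.ofReal (h x) ∂(surfaceMeasure Ω) ≤
        C * ∫⁻ x in Ω, (ENNReal.ofReal (h x) + ‖gradient h x‖ₑ) := by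
  have hcomp : IsCompact (frontier Ω) :=
    Metric.isCompact_of_isClosed_isBounded isClosed_frontier
      (hΩ.isBounded.closure.subset frontier_subset_closure)
  refine hcomp.induction_on (p := fun s ↦ ∃ C : ℝ≥0∞, C ≠ ⊤ ∧ ∀ h : RSpace N → ℝ,
      ContDiff ℝ 1 h → ∫⁻ x in s, ENNReal.ofReal (h x)
        ∂(Measure.euclideanHausdorffMeasure (N - 1)) ≤
      C * ∫⁻ x in Ω, (ENNReal.ofReal (h x) + ‖gradient h x‖ₑ)) ?_ ?_ ?_ ?_
  · exact ⟨0, by simp, fun h _ ↦ by simp⟩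
  · rintro s t hst ⟨C, hC, h⟩
    exact ⟨C, hC, fun f hf ↦ (lintegral_mono_set hst).trans (h f hf)⟩
  · rintro s t ⟨C, hC, hs⟩ ⟨D, hD, ht⟩
    refine ⟨C + D, by finiteness, fun f hf ↦ (lintegral_union_le _ _ _).trans ?_⟩
    rw [add_mul]
    exact add_le_add (hs f hf) (ht f hf)
  · intro z hz
    obtain ⟨ρ, hρ, C, hC, h⟩ := exists_local_trace_bound hN hΩ.isOpen hΩ.boundary hz
    refine ⟨frontier Ω ∩ Metric.ball z ρ, ?_, C, hC, h⟩
    exact inter_mem_nhdsWithin _ (Metric.ball_mem_nhds z hρ)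

/-- The boundary has finite surface measure: this is the trace inequality for the constant `1`. -/
theorem isFiniteMeasure_surfaceMeasure {N : ℕ} (hN : 1 ≤ N) {Ω : Set (RSpace N)}
    (hΩ : IsBoundedC2Domain Ω) : IsFiniteMeasure (surfaceMeasure Ω) := by
  obtain ⟨C, hC, h⟩ := exists_trace_bound hN hΩ
  refine ⟨?_⟩
  have h1 := h (fun _ ↦ 1) contDiff_const
  have h2 : ∀ x : RSpace N, gradient (fun _ : RSpace N ↦ (1 : ℝ)) x = 0 := fun x ↦ by
    simp [gradient]
  simp only [ENNReal.ofReal_one, lintegral_const, one_mul, h2, enorm_zero, add_zero] at h1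
  refine h1.trans_lt (ENNReal.mul_lt_top hC.lt_top ?_)
  rw [Measure.restrict_apply_univ]
  exact hΩ.isBounded.measure_lt_top

/-! ### Order properties of traces -/

/-- The `p`-th power of the positive part is differentiable, also at `0`, because `1 < p`. -/
theorem hasDerivAt_max_zero_rpow {p : ℝ} (hp : 1 < p) (t : ℝ) :
    HasDerivAt (fun t : ℝ ↦ max t 0 ^ p) (p * max t 0 ^ (p - 1)) t := by
  have hne : ∀ t : ℝ, t ≠ 0 → HasDerivAt (fun t : ℝ ↦ max t 0 ^ p) (p * max t 0 ^ (p - 1)) t := by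
    intro t ht
    rcases lt_or_gt_of_ne ht with h | h
    · have h1 : (fun t : ℝ ↦ max t 0 ^ p) =ᶠ[𝓝 t] fun _ ↦ 0 := by
        filter_upwards [Iio_mem_nhds h] with s hs
        rw [max_eq_right (le_of_lt hs), Real.zero_rpow (by linarith)]
      have h2 : p * max t 0 ^ (p - 1) = 0 := by
        rw [max_eq_right h.le, Real.zero_rpow (by linarith), mul_zero]
      rw [h2]
      exact (hasDerivAt_const t (0 : ℝ)).congr_of_eventuallyEq h1
    · have h1 : (fun t : ℝ ↦ max t 0 ^ p) =ᶠ[𝓝 t] fun t ↦ t ^ p := by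
        filter_upwards [Ioi_mem_nhds h] with s hs
        rw [max_eq_left (le_of_lt hs)]
      rw [max_eq_left h.le]
      exact (Real.hasDerivAt_rpow_const (Or.inl ht)).congr_of_eventuallyEq h1
  rcases eq_or_ne t 0 with rfl | ht
  · refine hasDerivAt_of_hasDerivAt_of_ne (g := fun t ↦ p * max t 0 ^ (p - 1)) (fun y hy ↦ hne y hy)
      ?_ ?_
    · exact ((continuous_id.max continuous_const).rpow_const
        (fun _ ↦ Or.inr (by linarith))).continuousAt
    · exact (continuous_const.mul ((continuous_id.max continuous_const).rpow_const
        (fun _ ↦ Or.inr (by linarith)))).continuousAt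
  · exact hne t ht

theorem contDiff_max_zero_rpow {p : ℝ} (hp : 1 < p) : ContDiff ℝ 1 (fun t : ℝ ↦ max t 0 ^ p) := by
  rw [contDiff_one_iff_deriv]
  refine ⟨fun t ↦ (hasDerivAt_max_zero_rpow hp t).differentiableAt, ?_⟩
  rw [show deriv (fun t : ℝ ↦ max t 0 ^ p) = fun t ↦ p * max t 0 ^ (p - 1) from
    funext fun t ↦ (hasDerivAt_max_zero_rpow hp t).deriv]
  exact continuous_const.mul ((continuous_id.max continuous_const).rpow_const
    (fun _ ↦ Or.inr (by linarith)))

theorem eLpNorm_ofReal_eq {α F : Type*} [MeasurableSpace α] [NormedAddCommGroup F] {μ : Measure α}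
    {p : ℝ} (hp : 0 < p) (f : α → F) :
    eLpNorm f (ENNReal.ofReal p) μ = (∫⁻ x, ‖f x‖ₑ ^ p ∂μ) ^ (1 / p) := by
  rw [eLpNorm_eq_lintegral_rpow_enorm_toReal (by simpa using hp) ENNReal.ofReal_ne_top,
    ENNReal.toReal_ofReal hp.le]

theorem continuous_gradient {N : ℕ} {f : RSpace N → ℝ} (hf : ContDiff ℝ 1 f) :
    Continuous (gradient f) :=
  (InnerProductSpace.toDual ℝ (RSpace N)).symm.continuous.comp (hf.continuous_fderiv one_ne_zero)

/-- The interpolated trace inequality for positive parts, from the `L¹` inequality for the `C¹`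
function `(f⁺)^p`. The last term carries the power `1 / q` of the `L^p` integral of `f⁺`: if `f⁺`
tends to `0` in `L^p(Ω)`, the gradients need only stay bounded for the traces to tend to `0`. -/
theorem exists_trace_posPart_bound {N : ℕ} (hN : 1 ≤ N) {Ω : Set (RSpace N)}
    (hΩ : IsBoundedC2Domain Ω) {p q : ℝ} (hpq : p.HolderConjugate q) :
    ∃ C : ℝ≥0∞, C ≠ ⊤ ∧ ∀ f : RSpace N → ℝ, ContDiff ℝ 1 f →
      ∫⁻ x, ENNReal.ofReal (f x) ^ p ∂(surfaceMeasure Ω) ≤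
        C * ((∫⁻ x in Ω, ENNReal.ofReal (f x) ^ p) +
          ENNReal.ofReal p * ((∫⁻ x in Ω, ENNReal.ofReal (f x) ^ p) ^ (1 / q) *
            eLpNorm (gradient f) (ENNReal.ofReal p) (volume.restrict Ω))) := by
  obtain ⟨C, hC, h⟩ := exists_trace_bound hN hΩ
  have hp := hpq.lt
  refine ⟨C, hC, fun f hf ↦ ?_⟩
  have hpow : ∀ {s : ℝ} (_ : 0 < s) (t : ℝ),
      ENNReal.ofReal (max t 0 ^ s) = ENNReal.ofReal t ^ s := by
    intro s hs t
    rw [← ENNReal.ofReal_rpow_of_nonneg (le_max_right _ _) hs.le]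
    congr 1
    rcases le_total t 0 with h | h
    · simp [h]
    · simp [h]
  have h1 := h (fun x ↦ max (f x) 0 ^ p) ((contDiff_max_zero_rpow hp).comp hf)
  have hgrad : ∀ x, ‖gradient (fun x ↦ max (f x) 0 ^ p) x‖ₑ =
      ENNReal.ofReal p * (ENNReal.ofReal (f x) ^ (p - 1) * ‖gradient f x‖ₑ) := by
    intro x
    have h2 : HasFDerivAt (fun x ↦ max (f x) 0 ^ p)
        ((p * max (f x) 0 ^ (p - 1)) • fderiv ℝ f x) x :=
      (hasDerivAt_max_zero_rpow hp (f x)).comp_hasFDerivAt x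
        ((hf.differentiable one_ne_zero) x).hasFDerivAt
    rw [gradient, gradient, h2.fderiv, map_smul, enorm_smul, ← mul_assoc, ← hpow (by linarith),
      ← ENNReal.ofReal_mul (by linarith)]
    congr 1
    rw [Real.enorm_eq_ofReal (by have := le_max_right (f x) 0; positivity)]
  simp only [hpow hpq.pos, hgrad] at h1
  have hm : Measurable fun x ↦ ENNReal.ofReal (f x) :=
    ENNReal.measurable_ofReal.comp hf.continuous.measurable
  have hmg : Measurable fun x ↦ ‖gradient f x‖ₑ := (continuous_gradient hf).measurable.enorm
  refine h1.trans (mul_le_mul_right ?_ _)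
  rw [lintegral_add_left (hm.pow_const _), lintegral_const_mul' _ _ ENNReal.ofReal_ne_top]
  refine add_le_add le_rfl (mul_le_mul_right ?_ _)
  have h3 := ENNReal.lintegral_mul_le_Lp_mul_Lq (volume.restrict Ω) hpq.symm
    (f := fun x ↦ ENNReal.ofReal (f x) ^ (p - 1)) (g := fun x ↦ ‖gradient f x‖ₑ)
    (hm.pow_const _).aemeasurable hmg.aemeasurable
  simp only [Pi.mul_apply, ← ENNReal.rpow_mul, hpq.sub_one_mul_conj] at h3
  rwa [eLpNorm_ofReal_eq hpq.pos]

/-- Traces of nonpositive functions are nonpositive. The gradients of the approximating functions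
only have to be bounded, so nothing has to be known about weak gradients of positive parts. -/
theorem trace_nonpos {N : ℕ} (hN : 1 ≤ N) {Ω : Set (RSpace N)} (hΩ : IsBoundedC2Domain Ω)
    {p : ℝ} (hp : 1 < p) {f : ℕ → RSpace N → ℝ} (hf : ∀ n, ContDiff ℝ 1 (f n))
    {U W : RSpace N → ℝ} (hW : AEStronglyMeasurable W (surfaceMeasure Ω))
    (hU : ∀ᵐ x ∂(volume.restrict Ω), U x ≤ 0)
    (h1 : Tendsto (fun n ↦ eLpNorm (fun x ↦ f n x - U x) (ENNReal.ofReal p) (volume.restrict Ω))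
      atTop (𝓝 0))
    {B : ℝ≥0∞} (hB : B ≠ ⊤)
    (h2 : ∀ᶠ n in atTop, eLpNorm (gradient (f n)) (ENNReal.ofReal p) (volume.restrict Ω) ≤ B)
    (h3 : Tendsto (fun n ↦ eLpNorm (fun x ↦ f n x - W x) (ENNReal.ofReal p) (surfaceMeasure Ω))
      atTop (𝓝 0)) :
    ∀ᵐ x ∂(surfaceMeasure Ω), W x ≤ 0 := by
  have hpq : p.HolderConjugate p.conjExponent := Real.HolderConjugate.conjExponent hp
  set q := p.conjExponent
  have hp0 : 0 < p := hpq.pos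
  obtain ⟨C, hC, hbound⟩ := exists_trace_posPart_bound hN hΩ hpq
  have hroot : ∀ {μ : Measure (RSpace N)} {F : ℕ → RSpace N → ℝ},
      Tendsto (fun n ↦ eLpNorm (F n) (ENNReal.ofReal p) μ) atTop (𝓝 0) →
      Tendsto (fun n ↦ ∫⁻ x, ‖F n x‖ₑ ^ p ∂μ) atTop (𝓝 0) := by
    intro μ F hF
    have h4 := (ENNReal.continuous_rpow_const (y := p)).tendsto 0 |>.comp hF
    rw [ENNReal.zero_rpow_of_pos hp0] at h4
    refine h4.congr fun n ↦ ?_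
    rw [Function.comp_apply, eLpNorm_ofReal_eq hp0, ← ENNReal.rpow_mul, one_div,
      inv_mul_cancel₀ hp0.ne', ENNReal.rpow_one]
  have hA : Tendsto (fun n ↦ ∫⁻ x in Ω, ENNReal.ofReal (f n x) ^ p) atTop (𝓝 0) := by
    refine tendsto_of_tendsto_of_tendsto_of_le_of_le tendsto_const_nhds (hroot h1)
      (fun _ ↦ zero_le) fun n ↦ lintegral_mono_ae ?_
    filter_upwards [hU] with x hx
    refine ENNReal.rpow_le_rpow ?_ hp0.le
    rw [← ofReal_norm]
    exact ENNReal.ofReal_le_ofReal ((by linarith : f n x ≤ f n x - U x).trans (Real.le_norm_self _))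
  have hS : Tendsto (fun n ↦ ∫⁻ x, ENNReal.ofReal (f n x) ^ p ∂(surfaceMeasure Ω)) atTop (𝓝 0) := by
    have h4 : Tendsto (fun n ↦ C * ((∫⁻ x in Ω, ENNReal.ofReal (f n x) ^ p) +
        ENNReal.ofReal p * ((∫⁻ x in Ω, ENNReal.ofReal (f n x) ^ p) ^ (1 / q) * B)))
        atTop (𝓝 0) := by
      have h5 := (ENNReal.continuous_rpow_const (y := 1 / q)).tendsto 0 |>.comp hA
      rw [ENNReal.zero_rpow_of_pos (one_div_pos.2 hpq.symm.pos)] at h5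
      have h6 := ENNReal.Tendsto.mul_const h5 (Or.inr hB)
      have h7 := ENNReal.Tendsto.const_mul (a := ENNReal.ofReal p) h6
        (Or.inr ENNReal.ofReal_ne_top)
      have h8 := ENNReal.Tendsto.const_mul (a := C) (hA.add h7) (Or.inr hC)
      simpa using h8
    refine tendsto_of_tendsto_of_tendsto_of_le_of_le' tendsto_const_nhds h4
      (Eventually.of_forall fun _ ↦ zero_le) ?_
    filter_upwards [h2] with n hn
    refine (hbound _ (hf n)).trans ?_
    gcongr
  have hT : Tendsto (fun n ↦ 2 ^ (p - 1) * ((∫⁻ x, ENNReal.ofReal (f n x) ^ p ∂(surfaceMeasure Ω)) +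
      ∫⁻ x, ‖f n x - W x‖ₑ ^ p ∂(surfaceMeasure Ω))) atTop (𝓝 0) := by
    have := ENNReal.Tendsto.const_mul (a := 2 ^ (p - 1)) (hS.add (hroot h3))
      (Or.inr (by finiteness))
    simpa using this
  have hz : ∫⁻ x, ENNReal.ofReal (W x) ^ p ∂(surfaceMeasure Ω) = 0 := by
    refine le_antisymm (ge_of_tendsto' hT fun n ↦ ?_) zero_le
    rw [← lintegral_add_left, ← lintegral_const_mul' _ _ (by finiteness)]
    · refine lintegral_mono fun x ↦ ?_
      refine le_trans ?_ (ENNReal.rpow_add_le_mul_rpow_add_rpow _ _ hp.le)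
      refine ENNReal.rpow_le_rpow ?_ hp0.le
      rw [← ofReal_norm]
      refine le_trans (ENNReal.ofReal_le_ofReal ?_) ENNReal.ofReal_add_le
      have := neg_abs_le (f n x - W x)
      rw [Real.norm_eq_abs]
      linarith
    · exact (ENNReal.measurable_ofReal.comp (hf n).continuous.measurable).pow_const _
  rw [lintegral_eq_zero_iff'] at hz
  · filter_upwards [hz] with x hx
    simpa [hp0, hp0.le, hp0.not_gt] using hx
  · exact (ENNReal.measurable_ofReal.comp_aemeasurable hW.aemeasurable).pow_const _

section TraceBounds

variable {N : ℕ} {Ω : Set (RSpace N)} {p : ℝ}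

theorem aestronglyMeasurable_of_contDiff {f : RSpace N → ℝ} (hf : ContDiff ℝ 1 f)
    (μ : Measure (RSpace N)) : AEStronglyMeasurable f μ :=
  hf.continuous.aestronglyMeasurable

theorem eventually_eLpNorm_le_of_tendsto {α F : Type*} [MeasurableSpace α] [NormedAddCommGroup F]
    {μ : Measure α} {p : ℝ≥0∞} (hp : 1 ≤ p) {f : ℕ → α → F} {g : α → F}
    (hf : ∀ n, AEStronglyMeasurable (f n) μ) (hg : AEStronglyMeasurable g μ)
    (h : Tendsto (fun n ↦ eLpNorm (fun x ↦ f n x - g x) p μ) atTop (𝓝 0)) :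
    ∀ᶠ n in atTop, eLpNorm (f n) p μ ≤ 1 + eLpNorm g p μ := by
  filter_upwards [h.eventually_le_const one_pos] with n hn
  calc eLpNorm (f n) p μ = eLpNorm ((fun x ↦ f n x - g x) + g) p μ := by
        congr 1; ext x; simp
    _ ≤ _ := (eLpNorm_add_le ((hf n).sub hg) hg hp).trans (add_le_add hn le_rfl)

theorem eLpNorm_const_sub_sub {α F : Type*} [MeasurableSpace α] [NormedAddCommGroup F]
    {μ : Measure α} {p : ℝ≥0∞} (c : F) (f g : α → F) :
    eLpNorm (fun x ↦ c - f x - (c - g x)) p μ = eLpNorm (fun x ↦ f x - g x) p μ :=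
  eLpNorm_congr_norm_ae (Eventually.of_forall fun x ↦ by
    rw [sub_sub_sub_cancel_left, norm_sub_rev])

theorem one_le_ofReal (hp : 1 < p) : 1 ≤ ENNReal.ofReal p := by
  simpa using ENNReal.ofReal_le_ofReal hp.le

theorem IsTrace.ae_le_const (hN : 1 ≤ N) (hΩ : IsBoundedC2Domain Ω) (hp : 1 < p)
    {u : SobolevW Ω p} {w : Lp ℝ (ENNReal.ofReal p) (surfaceMeasure Ω)} (h : IsTrace u w) {c : ℝ}
    (hu : ∀ᵐ x ∂(volume.restrict Ω), u.val x ≤ c) : ∀ᵐ x ∂(surfaceMeasure Ω), w x ≤ c := by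
  obtain ⟨f, hf, h1, h2, h3⟩ := h
  have h4 := trace_nonpos hN hΩ hp (f := fun n x ↦ f n x - c) (U := fun x ↦ u.val x - c)
    (W := fun x ↦ w x - c) (B := 1 + eLpNorm u.grad (ENNReal.ofReal p) (volume.restrict Ω))
    (fun n ↦ (hf n).sub contDiff_const)
    ((Lp.aestronglyMeasurable w).sub aestronglyMeasurable_const)
    (by filter_upwards [hu] with x hx; linarith) (by simpa using h1)
    (by have := Lp.eLpNorm_ne_top u.grad; finiteness) ?_ (by simpa using h3)
  · filter_upwards [h4] with x hx; linarith
  · have h5 : ∀ n, gradient (fun x ↦ f n x - c) = gradient (f n) := fun n ↦ by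
      ext1 x; simp [gradient, fderiv_sub_const]
    simp only [h5]
    exact eventually_eLpNorm_le_of_tendsto (one_le_ofReal hp)
      (fun n ↦ (continuous_gradient (hf n)).aestronglyMeasurable) (Lp.aestronglyMeasurable _) h2

theorem IsTrace.ae_const_le (hN : 1 ≤ N) (hΩ : IsBoundedC2Domain Ω) (hp : 1 < p)
    {u : SobolevW Ω p} {w : Lp ℝ (ENNReal.ofReal p) (surfaceMeasure Ω)} (h : IsTrace u w) {c : ℝ}
    (hu : ∀ᵐ x ∂(volume.restrict Ω), c ≤ u.val x) : ∀ᵐ x ∂(surfaceMeasure Ω), c ≤ w x := by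
  obtain ⟨f, hf, h1, h2, h3⟩ := h
  have h4 := trace_nonpos hN hΩ hp (f := fun n x ↦ c - f n x) (U := fun x ↦ c - u.val x)
    (W := fun x ↦ c - w x) (B := 1 + eLpNorm u.grad (ENNReal.ofReal p) (volume.restrict Ω))
    (fun n ↦ contDiff_const.sub (hf n))
    (aestronglyMeasurable_const.sub (Lp.aestronglyMeasurable w))
    (by filter_upwards [hu] with x hx; linarith) ?_
    (by have := Lp.eLpNorm_ne_top u.grad; finiteness) ?_ ?_
  · filter_upwards [h4] with x hx; linarith
  · simpa only [eLpNorm_const_sub_sub] using h1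
  · have h5 : ∀ n, gradient (fun x ↦ c - f n x) = -gradient (f n) := fun n ↦ by
      ext1 x; simp [gradient, fderiv_const_sub]
    simp only [h5, eLpNorm_neg]
    exact eventually_eLpNorm_le_of_tendsto (one_le_ofReal hp)
      (fun n ↦ (continuous_gradient (hf n)).aestronglyMeasurable) (Lp.aestronglyMeasurable _) h2
  · simpa only [eLpNorm_const_sub_sub] using h3

end TraceBounds

/-! ### The vector inequalities of the `p`-Laplacian -/

/-- If a continuous function `f` is nonpositive at the zeros of a continuous function `g ≥ 0`, and
both are homogeneous of degree `p`, then `f` is bounded by a multiple of `g` up to an arbitrarily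
small multiple of `‖x‖ ^ p`. On the unit sphere this is compactness. -/
theorem exists_le_add_mul_of_homogeneous {X : Type*} [NormedAddCommGroup X] [NormedSpace ℝ X]
    [FiniteDimensional ℝ X] {p : ℝ} (hp : 0 < p) {f g : X → ℝ} (hf : Continuous f)
    (hg : Continuous g) (hfh : ∀ t > 0, ∀ x, f (t • x) = t ^ p * f x)
    (hgh : ∀ t > 0, ∀ x, g (t • x) = t ^ p * g x) (hg0 : ∀ x, 0 ≤ g x)
    (h : ∀ x, g x = 0 → f x ≤ 0) {η : ℝ} (hη : 0 < η) :
    ∃ C, 0 ≤ C ∧ ∀ x, f x ≤ η * ‖x‖ ^ p + C * g x := by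
  have hsph : ∃ C, 0 ≤ C ∧ ∀ x ∈ Metric.sphere (0 : X) 1, f x ≤ η + C * g x := by
    have hS : IsCompact (Metric.sphere (0 : X) 1) := isCompact_sphere 0 1
    have hK : IsCompact (Metric.sphere (0 : X) 1 ∩ {x | η ≤ f x}) :=
      hS.inter_right (isClosed_le continuous_const hf)
    rcases (Metric.sphere (0 : X) 1 ∩ {x | η ≤ f x}).eq_empty_or_nonempty with he | hne
    · refine ⟨0, le_rfl, fun x hx ↦ ?_⟩
      by_contra! hlt
      have : x ∈ Metric.sphere (0 : X) 1 ∩ {x | η ≤ f x} := ⟨hx, by simp at hlt; exact hlt.le⟩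
      rw [he] at this
      exact this
    · obtain ⟨x₀, hx₀, hmin⟩ := hK.exists_isMinOn hne hg.continuousOn
      obtain ⟨x₁, hx₁, hmax⟩ := hK.exists_isMaxOn hne hf.continuousOn
      have hd : 0 < g x₀ := (hg0 x₀).lt_of_ne fun h0 ↦ by
        have h1 : f x₀ ≤ 0 := h x₀ h0.symm
        have h2 : η ≤ f x₀ := hx₀.2
        linarith
      have hF : 0 < f x₁ := hη.trans_le hx₁.2
      refine ⟨f x₁ / g x₀, by positivity, fun x hx ↦ ?_⟩
      rcases lt_or_ge (f x) η with hlt | hge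
      · have := hg0 x
        have : 0 ≤ f x₁ / g x₀ * g x := by positivity
        linarith
      · have h1 : g x₀ ≤ g x := hmin ⟨hx, hge⟩
        have h2 : f x ≤ f x₁ := hmax ⟨hx, hge⟩
        have h3 : f x₁ / g x₀ * g x₀ ≤ f x₁ / g x₀ * g x := by gcongr
        rw [div_mul_cancel₀ _ hd.ne'] at h3
        linarith
  obtain ⟨C, hC, hb⟩ := hsph
  refine ⟨C, hC, fun x ↦ ?_⟩
  rcases eq_or_ne x 0 with rfl | hx
  · have h1 := hfh 2 two_pos 0
    rw [smul_zero] at h1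
    have h2 : (1 : ℝ) < 2 ^ p := Real.one_lt_rpow (by norm_num) hp
    have h3 : f 0 = 0 := by nlinarith
    have := mul_nonneg hC (hg0 0)
    rw [norm_zero, Real.zero_rpow hp.ne', h3]
    linarith
  · have hn : 0 < ‖x‖ := norm_pos_iff.2 hx
    have h1 := hb (‖x‖⁻¹ • x) (by simp [norm_smul, hn.ne'])
    have h2 : x = ‖x‖ • (‖x‖⁻¹ • x) := by rw [smul_smul, mul_inv_cancel₀ hn.ne', one_smul]
    have h3 : f x = ‖x‖ ^ p * f (‖x‖⁻¹ • x) := by rw [← hfh _ hn, ← h2]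
    have h4 : g x = ‖x‖ ^ p * g (‖x‖⁻¹ • x) := by rw [← hgh _ hn, ← h2]
    have h5 : 0 ≤ ‖x‖ ^ p := by positivity
    rw [h3, h4]
    calc _ ≤ ‖x‖ ^ p * (η + C * g (‖x‖⁻¹ • x)) := by gcongr
      _ = _ := by ring

theorem norm_rpow_sub_two_mul_sq {E : Type*} [NormedAddCommGroup E] {p : ℝ} (hp : 1 < p)
    (a : E) : ‖a‖ ^ (p - 2) * ‖a‖ ^ 2 = ‖a‖ ^ p := by
  rcases eq_or_ne a 0 with rfl | ha
  · simp [Real.zero_rpow (by linarith : p ≠ 0)]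
  · rw [← Real.rpow_natCast, ← Real.rpow_add (norm_pos_iff.2 ha)]; norm_num

theorem norm_rpow_sub_two_mul {E : Type*} [NormedAddCommGroup E] {p : ℝ} (hp : 1 < p)
    (a : E) : ‖a‖ ^ (p - 2) * ‖a‖ = ‖a‖ ^ (p - 1) := by
  rcases eq_or_ne a 0 with rfl | ha
  · simp [Real.zero_rpow (by linarith : p - 1 ≠ 0)]
  · rw [← Real.rpow_add_one (norm_ne_zero_iff.2 ha)]; congr 1; ring

theorem norm_prod_rpow_le {E F : Type*} [NormedAddCommGroup E] [NormedAddCommGroup F] {p : ℝ}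
    (x : E × F) :
    ‖x‖ ^ p ≤ ‖x.1‖ ^ p + ‖x.2‖ ^ p := by
  rw [Prod.norm_def]
  rcases max_choice ‖x.1‖ ‖x.2‖ with h | h <;> rw [h]
  · exact le_add_of_nonneg_right (by positivity)
  · exact le_add_of_nonneg_left (by positivity)

section PPairing

variable {E : Type*} [NormedAddCommGroup E] [InnerProductSpace ℝ E] {p : ℝ}

/-- The pairing `⟨|a|^{p-2} a, c⟩` of the `p`-Laplacian. At `a = 0` it vanishes for every `p`,
whatever the value of the power of `0`. -/
noncomputable def pPairing (p : ℝ) (a c : E) : ℝ := ‖a‖ ^ (p - 2) * ⟪a, c⟫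

theorem pPairing_self (hp : 1 < p) (a : E) : pPairing p a a = ‖a‖ ^ p := by
  rw [pPairing, real_inner_self_eq_norm_sq, norm_rpow_sub_two_mul_sq hp]

theorem pPairing_sub_right (a b c : E) : pPairing p a (b - c) = pPairing p a b - pPairing p a c := by
  rw [pPairing, pPairing, pPairing, inner_sub_right, mul_sub]

theorem pPairing_smul_smul (hp : 1 < p) {t : ℝ} (ht : 0 < t) (a c : E) :
    pPairing p (t • a) (t • c) = t ^ p * pPairing p a c := by
  have h1 := norm_rpow_sub_two_mul_sq hp t
  rw [Real.norm_of_nonneg ht.le] at h1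
  rw [pPairing, pPairing, norm_smul, inner_smul_left, inner_smul_right,
    Real.norm_of_nonneg ht.le, Real.mul_rpow ht.le (norm_nonneg _), ← h1]
  simp only [conj_trivial]
  ring

/-- Up to the factor `p`, the pairing is the derivative of the `C¹` function `‖a‖ ^ p`. -/
theorem continuous_pPairing (hp : 1 < p) : Continuous fun x : E × E ↦ pPairing p x.1 x.2 := by
  have h1 : ∀ x : E × E, pPairing p x.1 x.2 = p⁻¹ * fderiv ℝ (fun x : E ↦ ‖x‖ ^ p) x.1 x.2 := by
    intro x
    rw [fderiv_norm_rpow _ hp, pPairing]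
    have : p ≠ 0 := by linarith
    simp only [smul_apply, innerSL_apply_apply, smul_eq_mul]
    field_simp
  simp only [h1]
  exact continuous_const.mul ((((contDiff_norm_rpow hp).continuous_fderiv one_ne_zero).comp
    continuous_fst).clm_apply continuous_snd)

theorem abs_pPairing_le (hp : 1 < p) (a c : E) : |pPairing p a c| ≤ ‖a‖ ^ p + ‖c‖ ^ p := by
  have h0 : |pPairing p a c| ≤ ‖a‖ ^ (p - 1) * ‖c‖ := by
    rw [pPairing, abs_mul, abs_of_nonneg (by positivity), ← norm_rpow_sub_two_mul hp, mul_assoc]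
    gcongr
    exact abs_real_inner_le_norm _ _
  refine h0.trans ?_
  have h2 : ∀ y : ℝ, 0 ≤ y → y ^ (p - 1) * y = y ^ p := by
    intro y hy
    have := norm_rpow_sub_two_mul_sq hp y
    have h3 := norm_rpow_sub_two_mul hp y
    rw [Real.norm_of_nonneg hy] at this h3
    rw [← this, ← h3]; ring
  rcases le_total ‖a‖ ‖c‖ with h | h
  · calc ‖a‖ ^ (p - 1) * ‖c‖ ≤ ‖c‖ ^ (p - 1) * ‖c‖ := by
          gcongr
      _ = ‖c‖ ^ p := h2 _ (norm_nonneg c)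
      _ ≤ _ := le_add_of_nonneg_left (by positivity)
  · calc ‖a‖ ^ (p - 1) * ‖c‖ ≤ ‖a‖ ^ (p - 1) * ‖a‖ := by gcongr
      _ = ‖a‖ ^ p := h2 _ (norm_nonneg a)
      _ ≤ _ := le_add_of_nonneg_right (by positivity)

/-- The expression whose sign is the monotonicity of `a ↦ |a|^{p-2} a`, as a sum of two nonnegative
terms: the first compares the norms, the second the directions. -/
theorem pPairing_sub_eq (hp : 1 < p) (a b : E) :
    pPairing p a (a - b) - pPairing p b (a - b) =
      (‖a‖ ^ (p - 1) - ‖b‖ ^ (p - 1)) * (‖a‖ - ‖b‖) +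
        (‖a‖ ^ (p - 2) + ‖b‖ ^ (p - 2)) * (‖a‖ * ‖b‖ - ⟪a, b⟫) := by
  rw [← norm_rpow_sub_two_mul hp a, ← norm_rpow_sub_two_mul hp b]
  simp only [pPairing, inner_sub_right, real_inner_self_eq_norm_sq, real_inner_comm a b]
  ring

theorem rpow_sub_mul_sub_nonneg {s x y : ℝ} (hs : 0 < s) (hx : 0 ≤ x) (hy : 0 ≤ y) :
    0 ≤ (x ^ s - y ^ s) * (x - y) := by
  rcases le_total x y with h | h
  · exact mul_nonneg_of_nonpos_of_nonpos
      (sub_nonpos.2 (Real.rpow_le_rpow hx h hs.le)) (sub_nonpos.2 h)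
  · exact mul_nonneg (sub_nonneg.2 (Real.rpow_le_rpow hy h hs.le)) (sub_nonneg.2 h)

theorem pPairing_sub_nonneg (hp : 1 < p) (a b : E) :
    0 ≤ pPairing p a (a - b) - pPairing p b (a - b) := by
  rw [pPairing_sub_eq hp]
  have h1 := rpow_sub_mul_sub_nonneg (by linarith : 0 < p - 1) (norm_nonneg a) (norm_nonneg b)
  have h2 := sub_nonneg.2 (real_inner_le_norm a b)
  positivity

theorem eq_of_pPairing_sub_eq_zero (hp : 1 < p) {a b : E}
    (h : pPairing p a (a - b) - pPairing p b (a - b) = 0) : a = b := by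
  rw [pPairing_sub_eq hp] at h
  have h1 := rpow_sub_mul_sub_nonneg (by linarith : 0 < p - 1) (norm_nonneg a) (norm_nonneg b)
  have h2 := sub_nonneg.2 (real_inner_le_norm a b)
  have h3 : 0 ≤ (‖a‖ ^ (p - 2) + ‖b‖ ^ (p - 2)) * (‖a‖ * ‖b‖ - ⟪a, b⟫) := by positivity
  have h4 : ‖a‖ = ‖b‖ := by
    rcases mul_eq_zero.1 (by linarith : (‖a‖ ^ (p - 1) - ‖b‖ ^ (p - 1)) * (‖a‖ - ‖b‖) = 0)
      with h5 | h5
    · exact (Real.rpow_left_inj (norm_nonneg a) (norm_nonneg b) (by linarith)).1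
        (sub_eq_zero.1 h5)
    · exact sub_eq_zero.1 h5
  rcases eq_or_ne a 0 with rfl | ha
  · rw [norm_zero] at h4
    exact (norm_eq_zero.1 h4.symm).symm
  · have hn : 0 < ‖a‖ := norm_pos_iff.2 ha
    have h5 : 0 < ‖a‖ ^ (p - 2) := by positivity
    have h6 : 0 ≤ ‖b‖ ^ (p - 2) := by positivity
    have h7 : ‖a‖ * ‖b‖ - ⟪a, b⟫ = 0 := by
      rcases mul_eq_zero.1 (by linarith :
        (‖a‖ ^ (p - 2) + ‖b‖ ^ (p - 2)) * (‖a‖ * ‖b‖ - ⟪a, b⟫) = 0) with h8 | h8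
      · linarith
      · exact h8
    have h8 := (inner_eq_norm_mul_iff_real).1 (sub_eq_zero.1 h7).symm
    rw [h4] at h8
    exact (smul_right_injective E (h4 ▸ hn.ne') h8)

/-- Quantitative strict monotonicity of `a ↦ |a|^{p-2} a`, in one form for all `p > 1`. -/
theorem exists_norm_sub_rpow_le [FiniteDimensional ℝ E] (hp : 1 < p) {η : ℝ} (hη : 0 < η) :
    ∃ C, 0 ≤ C ∧ ∀ a b : E, ‖a - b‖ ^ p ≤
      η * (‖a‖ ^ p + ‖b‖ ^ p) + C * (pPairing p a (a - b) - pPairing p b (a - b)) := by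
  have hc := continuous_pPairing (E := E) hp
  obtain ⟨C, hC, h⟩ := exists_le_add_mul_of_homogeneous (X := E × E) (p := p) (by linarith)
    (f := fun x ↦ ‖x.1 - x.2‖ ^ p)
    (g := fun x ↦ pPairing p x.1 (x.1 - x.2) - pPairing p x.2 (x.1 - x.2))
    ((continuous_fst.sub continuous_snd).norm.rpow_const fun _ ↦ Or.inr (by linarith))
    ((hc.comp (continuous_fst.prodMk (continuous_fst.sub continuous_snd))).sub
      (hc.comp (continuous_snd.prodMk (continuous_fst.sub continuous_snd))))
    (fun t ht x ↦ by
      simp only [Prod.smul_fst, Prod.smul_snd, ← smul_sub, norm_smul, Real.norm_of_nonneg ht.le]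
      rw [Real.mul_rpow ht.le (norm_nonneg _)])
    (fun t ht x ↦ by
      simp only [Prod.smul_fst, Prod.smul_snd, ← smul_sub, pPairing_smul_smul hp ht]
      ring)
    (fun x ↦ pPairing_sub_nonneg hp _ _)
    (fun x hx ↦ by
      rw [eq_of_pPairing_sub_eq_zero hp hx, sub_self, norm_zero, Real.zero_rpow (by linarith)])
    hη
  refine ⟨C, hC, fun a b ↦ (h (a, b)).trans ?_⟩
  gcongr
  exact norm_prod_rpow_le (a, b)

/-- Quantitative continuity of `a ↦ |a|^{p-2} a`. -/
theorem exists_abs_pPairing_sub_le [FiniteDimensional ℝ E] (hp : 1 < p) {η : ℝ} (hη : 0 < η) :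
    ∃ C, 0 ≤ C ∧ ∀ a b c : E, |pPairing p a c - pPairing p b c| ≤
      η * (‖a‖ ^ p + ‖b‖ ^ p + ‖c‖ ^ p) + C * ‖a - b‖ ^ p := by
  have hc := continuous_pPairing (E := E) hp
  obtain ⟨C, hC, h⟩ := exists_le_add_mul_of_homogeneous (X := (E × E) × E) (p := p) (by linarith)
    (f := fun x ↦ |pPairing p x.1.1 x.2 - pPairing p x.1.2 x.2|)
    (g := fun x ↦ ‖x.1.1 - x.1.2‖ ^ p)
    ((hc.comp (continuous_fst.fst.prodMk continuous_snd)).sub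
      (hc.comp (continuous_fst.snd.prodMk continuous_snd))).abs
    ((continuous_fst.fst.sub continuous_fst.snd).norm.rpow_const fun _ ↦ Or.inr (by linarith))
    (fun t ht x ↦ by
      simp only [Prod.smul_fst, Prod.smul_snd, pPairing_smul_smul hp ht, ← mul_sub, abs_mul]
      rw [abs_of_nonneg (by positivity)])
    (fun t ht x ↦ by
      simp only [Prod.smul_fst, Prod.smul_snd, ← smul_sub, norm_smul, Real.norm_of_nonneg ht.le]
      rw [Real.mul_rpow ht.le (norm_nonneg _)])
    (fun x ↦ by positivity)
    (fun x hx ↦ by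
      rw [Real.rpow_eq_zero (norm_nonneg _) (by linarith), norm_sub_eq_zero_iff] at hx
      rw [hx, sub_self, abs_zero])
    hη
  refine ⟨C, hC, fun a b c ↦ (h ((a, b), c)).trans ?_⟩
  gcongr
  exact (norm_prod_rpow_le ((a, b), c)).trans
    (add_le_add (norm_prod_rpow_le (a, b)) le_rfl)

end PPairing

/-! ### Convergence in `L^p` -/

section LpConvergence

variable {α : Type*} [MeasurableSpace α] {μ : Measure α} {E : Type*} [NormedAddCommGroup E]
  {p : ℝ}

theorem MeasureTheory.Lp.integrable_norm_rpow (hp : 1 < p) (F : Lp E (ENNReal.ofReal p) μ) :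
    Integrable (fun x ↦ ‖F x‖ ^ p) μ := by
  have h := (Lp.memLp F).integrable_norm_rpow (by simp; linarith) ENNReal.ofReal_ne_top
  rwa [ENNReal.toReal_ofReal (by linarith)] at h

theorem MeasureTheory.Lp.integral_norm_rpow_eq (hp : 1 < p) (F : Lp E (ENNReal.ofReal p) μ) :
    ∫ x, ‖F x‖ ^ p ∂μ = ‖F‖ ^ p := by
  have h0 : 0 ≤ ∫ x, ‖F x‖ ^ p ∂μ := integral_nonneg fun x ↦ by positivity
  rw [Lp.norm_def, (Lp.memLp F).eLpNorm_eq_integral_rpow_norm (by simp; linarith)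
    ENNReal.ofReal_ne_top, ENNReal.toReal_ofReal (by linarith : 0 ≤ p),
    ENNReal.toReal_ofReal (by positivity), ← Real.rpow_mul h0,
    inv_mul_cancel₀ (by linarith), Real.rpow_one]

theorem MeasureTheory.Lp.integral_norm_sub_rpow_eq (hp : 1 < p) (F G : Lp E (ENNReal.ofReal p) μ) :
    ∫ x, ‖F x - G x‖ ^ p ∂μ = ‖F - G‖ ^ p := by
  rw [← Lp.integral_norm_rpow_eq hp]
  refine integral_congr_ae ?_
  filter_upwards [Lp.coeFn_sub F G] with x hx
  rw [hx, Pi.sub_apply]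

theorem MeasureTheory.Lp.integrable_norm_sub_rpow (hp : 1 < p) (F G : Lp E (ENNReal.ofReal p) μ) :
    Integrable (fun x ↦ ‖F x - G x‖ ^ p) μ := by
  refine (Lp.integrable_norm_rpow hp (F - G)).congr ?_
  filter_upwards [Lp.coeFn_sub F G] with x hx
  rw [hx, Pi.sub_apply]

/-- Integrals of expressions which are Lipschitz in an `L^p` function pass to the limit. -/
theorem tendsto_integral_of_norm_sub_le [IsFiniteMeasure μ] [Fact (1 ≤ ENNReal.ofReal p)]
    {G : Type*} [NormedAddCommGroup G] [NormedSpace ℝ G]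
    {F : ℕ → Lp E (ENNReal.ofReal p) μ} {F' : Lp E (ENNReal.ofReal p) μ}
    (hF : Tendsto F atTop (𝓝 F')) {h : ℕ → α → G} {h' : α → G} (hi : ∀ n, Integrable (h n) μ)
    (hi' : Integrable h' μ) {C : NNReal} (hle : ∀ n x, ‖h n x - h' x‖ ≤ C * ‖F n x - F' x‖) :
    Tendsto (fun n ↦ ∫ x, h n x ∂μ) atTop (𝓝 (∫ x, h' x ∂μ)) := by
  refine tendsto_integral_of_L1 h' hi'.1 (Eventually.of_forall hi) ?_
  have h1 := (Lp.tendsto_Lp_iff_tendsto_eLpNorm' _ _).1 hF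
  set K : ℝ≥0∞ := μ univ ^ (1 / (1 : ℝ≥0∞).toReal - 1 / (ENNReal.ofReal p).toReal)
  have hp : 1 ≤ ENNReal.ofReal p := Fact.out
  have hp' : 1 ≤ (ENNReal.ofReal p).toReal := by
    rw [← ENNReal.toReal_one]
    exact ENNReal.toReal_mono ENNReal.ofReal_ne_top hp
  have hK : K ≠ ⊤ := by
    refine ENNReal.rpow_ne_top_of_nonneg ?_ (measure_ne_top _ _)
    rw [ENNReal.toReal_one, div_one, sub_nonneg]
    exact div_le_one_of_le₀ hp' (by linarith)
  have h2 : Tendsto (fun n ↦ C * (eLpNorm (⇑(F n) - ⇑F') (ENNReal.ofReal p) μ * K)) atTop (𝓝 0) := by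
    have := ENNReal.Tendsto.const_mul (a := (C : ℝ≥0∞))
      (ENNReal.Tendsto.mul_const h1 (Or.inr hK)) (Or.inr ENNReal.coe_ne_top)
    simpa using this
  refine tendsto_of_tendsto_of_tendsto_of_le_of_le tendsto_const_nhds h2 (fun _ ↦ zero_le)
    fun n ↦ ?_
  have h3 := eLpNorm_le_eLpNorm_mul_rpow_measure_univ hp
    ((Lp.aestronglyMeasurable (F n)).sub (Lp.aestronglyMeasurable F'))
  calc ∫⁻ x, ‖h n x - h' x‖ₑ ∂μ ≤ ∫⁻ x, C * ‖F n x - F' x‖ₑ ∂μ := by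
        refine lintegral_mono fun x ↦ ?_
        rw [← ofReal_norm, ← ofReal_norm, ← ENNReal.ofReal_coe_nnreal,
          ← ENNReal.ofReal_mul C.coe_nonneg]
        exact ENNReal.ofReal_le_ofReal (hle n x)
    _ = C * eLpNorm (⇑(F n) - ⇑F') 1 μ := by
        rw [lintegral_const_mul' _ _ ENNReal.coe_ne_top, eLpNorm_one_eq_lintegral_enorm]
        rfl
    _ ≤ _ := mul_le_mul_right h3 _

/-- Bounded monotone sequences converge in `L^p` and almost everywhere. -/
theorem MeasureTheory.Lp.exists_tendsto_of_monotone [IsFiniteMeasure μ] [Fact (1 ≤ ENNReal.ofReal p)]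
    (hp : 1 < p) {F : ℕ → Lp ℝ (ENNReal.ofReal p) μ} (hF : Monotone F ∨ Antitone F) {M : ℝ}
    (hM : ∀ n, ∀ᵐ x ∂μ, |F n x| ≤ M) :
    ∃ F' : Lp ℝ (ENNReal.ofReal p) μ, Tendsto F atTop (𝓝 F') ∧
      ∀ᵐ x ∂μ, Tendsto (fun n ↦ F n x) atTop (𝓝 (F' x)) := by
  have hmono : ∀ᵐ x ∂μ, Monotone (fun n ↦ F n x) ∨ Antitone (fun n ↦ F n x) := by
    rcases hF with hF | hF
    · have h1 : ∀ᵐ x ∂μ, ∀ n, F n x ≤ F (n + 1) x :=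
        ae_all_iff.2 fun n ↦ (Lp.coeFn_le _ _).2 (hF n.le_succ)
      filter_upwards [h1] with x hx using Or.inl (monotone_nat_of_le_succ hx)
    · have h1 : ∀ᵐ x ∂μ, ∀ n, F (n + 1) x ≤ F n x :=
        ae_all_iff.2 fun n ↦ (Lp.coeFn_le _ _).2 (hF n.le_succ)
      filter_upwards [h1] with x hx using Or.inr (antitone_nat_of_succ_le hx)
  have hM' : ∀ᵐ x ∂μ, ∀ n, |F n x| ≤ M := ae_all_iff.2 hM
  have hlim : ∀ᵐ x ∂μ, ∃ l, Tendsto (fun n ↦ F n x) atTop (𝓝 l) := by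
    filter_upwards [hmono, hM'] with x h1 h2
    rcases h1 with h1 | h1
    · exact ⟨_, tendsto_atTop_ciSup h1 ⟨M, by rintro _ ⟨n, rfl⟩; exact (abs_le.1 (h2 n)).2⟩⟩
    · exact ⟨_, tendsto_atTop_ciInf h1 ⟨-M, by rintro _ ⟨n, rfl⟩; exact (abs_le.1 (h2 n)).1⟩⟩
  obtain ⟨f, hf, hfl⟩ := exists_stronglyMeasurable_limit_of_tendsto_ae
    (fun n ↦ Lp.aestronglyMeasurable (F n)) hlim
  have hfM : ∀ᵐ x ∂μ, |f x| ≤ M := by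
    filter_upwards [hfl, hM'] with x h1 h2
    exact le_of_tendsto' h1.abs h2
  have hfp : MemLp f (ENNReal.ofReal p) μ := MemLp.of_bound hf.aestronglyMeasurable M hfM
  have hae : ∀ᵐ x ∂μ, Tendsto (fun n ↦ F n x) atTop (𝓝 (hfp.toLp f x)) := by
    filter_upwards [hfl, hfp.coeFn_toLp] with x h1 h2
    rwa [h2]
  refine ⟨hfp.toLp f, ?_, hae⟩
  have h3 : Tendsto (fun n ↦ ∫ x, ‖F n x - hfp.toLp f x‖ ^ p ∂μ) atTop (𝓝 (∫ _, (0 : ℝ) ∂μ)) := by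
    refine tendsto_integral_of_dominated_convergence (fun _ ↦ (M + M) ^ p)
      (fun n ↦ (Lp.integrable_norm_sub_rpow hp _ _).1) (integrable_const _) (fun n ↦ ?_) ?_
    · filter_upwards [hM', hfM, hfp.coeFn_toLp] with x h1 h2 h3
      rw [Real.norm_of_nonneg (by positivity), h3]
      refine Real.rpow_le_rpow (norm_nonneg _) ?_ (by linarith)
      exact (norm_sub_le _ _).trans (add_le_add (h1 n) h2)
    · filter_upwards [hae] with x h1
      have h4 : Tendsto (fun n ↦ ‖F n x - hfp.toLp f x‖) atTop (𝓝 0) := by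
        simpa using (h1.sub_const (hfp.toLp f x)).norm
      have h5 := h4.rpow_const (p := p) (Or.inr (by linarith))
      rwa [Real.zero_rpow (by linarith)] at h5
  simp only [Lp.integral_norm_sub_rpow_eq hp, integral_zero] at h3
  have h4 := h3.rpow_const (p := p⁻¹) (Or.inr (inv_nonneg.2 (by linarith)))
  rw [Real.zero_rpow (inv_ne_zero (by linarith))] at h4
  rw [tendsto_iff_norm_sub_tendsto_zero]
  refine h4.congr fun n ↦ ?_
  rw [← Real.rpow_mul (norm_nonneg _), mul_inv_cancel₀ (by linarith), Real.rpow_one]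

variable [InnerProductSpace ℝ E]

theorem MeasureTheory.Lp.integrable_pPairing (hp : 1 < p) (F G : Lp E (ENNReal.ofReal p) μ) :
    Integrable (fun x ↦ pPairing p (F x) (G x)) μ := by
  refine ((Lp.integrable_norm_rpow hp F).add (Lp.integrable_norm_rpow hp G)).mono' ?_ ?_
  · exact (continuous_pPairing hp).comp_aestronglyMeasurable
      ((Lp.aestronglyMeasurable F).prodMk (Lp.aestronglyMeasurable G))
  · exact Eventually.of_forall fun x ↦ abs_pPairing_le hp _ _

theorem MeasureTheory.Lp.integrable_pPairing_sub (hp : 1 < p) (F G H : Lp E (ENNReal.ofReal p) μ) :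
    Integrable (fun x ↦ pPairing p (F x) (G x - H x)) μ := by
  simp only [pPairing_sub_right]
  exact (Lp.integrable_pPairing hp F G).sub (Lp.integrable_pPairing hp F H)

variable [FiniteDimensional ℝ E]

/-- `a ↦ |a|^{p-2} a` is continuous from `L^p` to its dual. -/
theorem MeasureTheory.Lp.tendsto_integral_pPairing [Fact (1 ≤ ENNReal.ofReal p)] (hp : 1 < p)
    {F : ℕ → Lp E (ENNReal.ofReal p) μ} {G : Lp E (ENNReal.ofReal p) μ}
    (hF : Tendsto F atTop (𝓝 G)) (Φ : Lp E (ENNReal.ofReal p) μ) :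
    Tendsto (fun n ↦ ∫ x, pPairing p (F n x) (Φ x) ∂μ) atTop
      (𝓝 (∫ x, pPairing p (G x) (Φ x) ∂μ)) := by
  have hp0 : 0 < p := by linarith
  obtain ⟨B, hBu⟩ := hF.norm.bddAbove_range
  have hB : ∀ n, ‖F n‖ ≤ B := fun n ↦ hBu ⟨n, rfl⟩
  have hB0 : 0 ≤ B := (norm_nonneg _).trans (hB 0)
  set K := B ^ p + ‖G‖ ^ p + ‖Φ‖ ^ p with hK
  have hK0 : 0 ≤ K := by positivity
  have hlim : Tendsto (fun n ↦ ‖F n - G‖ ^ p) atTop (𝓝 0) := by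
    have := (tendsto_iff_norm_sub_tendsto_zero.1 hF).rpow_const (p := p) (Or.inr hp0.le)
    rwa [Real.zero_rpow hp0.ne'] at this
  rw [Metric.tendsto_atTop]
  intro ε hε
  obtain ⟨C, hC, h⟩ := exists_abs_pPairing_sub_le (E := E) hp
    (η := ε / 2 / (K + 1)) (by positivity)
  have h2 : ∀ᶠ n in atTop, ‖F n - G‖ ^ p < ε / 2 / (C + 1) :=
    hlim.eventually_lt_const (by positivity)
  obtain ⟨n₀, hn₀⟩ := eventually_atTop.1 h2
  refine ⟨n₀, fun n hn ↦ ?_⟩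
  rw [Real.dist_eq, ← integral_sub (Lp.integrable_pPairing hp _ _) (Lp.integrable_pPairing hp _ _)]
  have i1 := Lp.integrable_norm_rpow hp (F n)
  have i2 := Lp.integrable_norm_rpow hp G
  have i3 := Lp.integrable_norm_rpow hp Φ
  have i4 := Lp.integrable_norm_sub_rpow hp (F n) G
  have i5 : Integrable (fun x ↦ ‖F n x‖ ^ p + ‖G x‖ ^ p) μ := i1.add i2
  have i6 : Integrable (fun x ↦ ‖F n x‖ ^ p + ‖G x‖ ^ p + ‖Φ x‖ ^ p) μ := i5.add i3
  calc |∫ x, pPairing p (F n x) (Φ x) - pPairing p (G x) (Φ x) ∂μ|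
      ≤ ∫ x, |pPairing p (F n x) (Φ x) - pPairing p (G x) (Φ x)| ∂μ := abs_integral_le_integral_abs
    _ ≤ ∫ x, (ε / 2 / (K + 1) * (‖F n x‖ ^ p + ‖G x‖ ^ p + ‖Φ x‖ ^ p)
          + C * ‖F n x - G x‖ ^ p) ∂μ := by
        refine integral_mono ?_ ?_ fun x ↦ h _ _ _
        · exact ((Lp.integrable_pPairing hp _ _).sub (Lp.integrable_pPairing hp _ _)).abs
        · exact (i6.const_mul _).add (i4.const_mul _)
    _ = ε / 2 / (K + 1) * (‖F n‖ ^ p + ‖G‖ ^ p + ‖Φ‖ ^ p) + C * ‖F n - G‖ ^ p := by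
        rw [integral_add (i6.const_mul _) (i4.const_mul _), integral_const_mul,
          integral_const_mul, integral_add i5 i3, integral_add i1 i2,
          Lp.integral_norm_rpow_eq hp, Lp.integral_norm_rpow_eq hp, Lp.integral_norm_rpow_eq hp,
          Lp.integral_norm_sub_rpow_eq hp]
    _ ≤ ε / 2 / (K + 1) * K + C * (ε / 2 / (C + 1)) := by
        gcongr
        · rw [hK]
          gcongr
          exact hB n
        · exact (hn₀ n hn).le
    _ < ε / 2 + ε / 2 := by
        refine add_lt_add ?_ ?_
        · rw [div_mul_eq_mul_div, div_lt_iff₀ (by positivity)]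
          nlinarith
        · rw [mul_div_assoc', div_lt_iff₀ (by positivity)]
          nlinarith
    _ = ε := by ring

/-- A bounded sequence is Cauchy in `L^p` if its differences are small when tested against the
monotone map `a ↦ |a|^{p-2} a`. -/
theorem MeasureTheory.Lp.cauchySeq_of_pPairing [Fact (1 ≤ ENNReal.ofReal p)] (hp : 1 < p)
    {F : ℕ → Lp E (ENNReal.ofReal p) μ} {K : ℝ} (hK : ∀ n, ‖F n‖ ^ p ≤ K)
    (h : ∀ ε > 0, ∃ n₀, ∀ m ≥ n₀, ∀ n ≥ n₀, (∫ x, pPairing p (F m x) (F m x - F n x) ∂μ) -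
      ∫ x, pPairing p (F n x) (F m x - F n x) ∂μ ≤ ε) :
    CauchySeq F := by
  have hp0 : 0 < p := by linarith
  have hK0 : 0 ≤ K := (by positivity : 0 ≤ ‖F 0‖ ^ p).trans (hK 0)
  rw [Metric.cauchySeq_iff]
  intro ε hε
  obtain ⟨C, hC, hb⟩ := exists_norm_sub_rpow_le (E := E) hp
    (η := ε ^ p / 2 / (2 * K + 1)) (by positivity)
  obtain ⟨n₀, hn₀⟩ := h (ε ^ p / 2 / (C + 1)) (by positivity)
  refine ⟨n₀, fun m hm n hn ↦ ?_⟩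
  have i1 := Lp.integrable_norm_rpow hp (F m)
  have i2 := Lp.integrable_norm_rpow hp (F n)
  have i3 := Lp.integrable_pPairing_sub hp (F m) (F m) (F n)
  have i4 := Lp.integrable_pPairing_sub hp (F n) (F m) (F n)
  have i5 : Integrable (fun x ↦ ‖F m x‖ ^ p + ‖F n x‖ ^ p) μ := i1.add i2
  have i6 : Integrable (fun x ↦ pPairing p (F m x) (F m x - F n x) -
      pPairing p (F n x) (F m x - F n x)) μ := i3.sub i4
  have h1 : ‖F m - F n‖ ^ p < ε ^ p := by
    calc ‖F m - F n‖ ^ p = ∫ x, ‖F m x - F n x‖ ^ p ∂μ := (Lp.integral_norm_sub_rpow_eq hp _ _).symm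
      _ ≤ ∫ x, (ε ^ p / 2 / (2 * K + 1) * (‖F m x‖ ^ p + ‖F n x‖ ^ p) +
            C * (pPairing p (F m x) (F m x - F n x) - pPairing p (F n x) (F m x - F n x))) ∂μ :=
          integral_mono (Lp.integrable_norm_sub_rpow hp _ _)
            ((i5.const_mul _).add (i6.const_mul _)) fun x ↦ hb _ _
      _ = ε ^ p / 2 / (2 * K + 1) * (‖F m‖ ^ p + ‖F n‖ ^ p) +
            C * ((∫ x, pPairing p (F m x) (F m x - F n x) ∂μ) -
              ∫ x, pPairing p (F n x) (F m x - F n x) ∂μ) := by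
          rw [integral_add (i5.const_mul _) (i6.const_mul _),
            integral_const_mul, integral_const_mul, integral_add i1 i2, integral_sub i3 i4,
            Lp.integral_norm_rpow_eq hp, Lp.integral_norm_rpow_eq hp]
      _ ≤ ε ^ p / 2 / (2 * K + 1) * (K + K) + C * (ε ^ p / 2 / (C + 1)) := by
          gcongr
          · exact hK m
          · exact hK n
          · exact hn₀ m hm n hn
      _ < ε ^ p / 2 + ε ^ p / 2 := by
          have : 0 < ε ^ p := by positivity
          refine add_lt_add ?_ ?_
          · rw [div_mul_eq_mul_div, div_lt_iff₀ (by positivity)]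
            nlinarith
          · rw [mul_div_assoc', div_lt_iff₀ (by positivity)]
            nlinarith
      _ = ε ^ p := by ring
  rw [dist_eq_norm_sub]
  exact lt_of_not_ge fun hge ↦ h1.not_ge (Real.rpow_le_rpow hε.le hge hp0.le)

end LpConvergence

/-! ### Closedness of the weak gradient and the trace, and stability of solutions -/

section SobolevClosure

variable {N : ℕ} {Ω : Set (RSpace N)} {p : ℝ}

theorem exists_bound_testFunction {φ : RSpace N → ℝ} (hφ : ContDiff ℝ ∞ φ)
    (hc : HasCompactSupport φ) :
    ∃ C : NNReal, (∀ x, ‖φ x‖ ≤ C) ∧ ∀ x, ‖gradient φ x‖ ≤ C := by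
  obtain ⟨C, hC⟩ := hc.exists_bound_of_continuous hφ.continuous
  obtain ⟨D, hD⟩ := (hc.fderiv ℝ).exists_bound_of_continuous
    (hφ.continuous_fderiv (by simp))
  have hg : ∀ x, ‖gradient φ x‖ = ‖fderiv ℝ φ x‖ := fun x ↦ by
    rw [gradient, LinearIsometryEquiv.norm_map]
  exact ⟨(max C D).toNNReal, fun x ↦ (hC x).trans ((le_max_left C D).trans (Real.le_coe_toNNReal _)),
    fun x ↦ (hg x).le.trans ((hD x).trans ((le_max_right C D).trans (Real.le_coe_toNNReal _)))⟩

theorem pPairing_real (a c : ℝ) : pPairing p a c = |a| ^ (p - 2) * a * c := by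
  simp only [pPairing, Real.norm_eq_abs, RCLike.inner_apply, conj_trivial]
  ring

/-- The interior integrals in the weak formulation always exist. -/
theorem solvesBoundaryProblem_iff (hp : 1 < p) {u : SobolevW Ω p} {b : RSpace N → ℝ} :
    SolvesBoundaryProblem u b ↔
      ∀ (φ : SobolevW Ω p) (ψ : Lp ℝ (ENNReal.ofReal p) (surfaceMeasure Ω)), IsTrace φ ψ →
        Integrable (fun x ↦ b x * ψ x) (surfaceMeasure Ω) ∧
        (∫ x in Ω, pPairing p (u.grad x) (φ.grad x)) + (∫ x in Ω, pPairing p (u.val x) (φ.val x))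
          = ∫ x, b x * ψ x ∂(surfaceMeasure Ω) := by
  simp only [pPairing_real]
  refine forall₂_congr fun φ ψ ↦ forall_congr' fun _ ↦ ⟨fun h ↦ h.2.2, fun h ↦ ⟨?_, ?_, h⟩⟩
  · exact Lp.integrable_pPairing hp u.grad φ.grad
  · simpa only [pPairing_real] using Lp.integrable_pPairing hp u.val φ.val

/-- The triangle inequality, stated for the representatives of elements of `L^q`. -/
theorem eLpNorm_sub_sub_sub_le {α F : Type*} [MeasurableSpace α] [NormedAddCommGroup F]
    {μ : Measure α} {q : ℝ≥0∞} [Fact (1 ≤ q)] {f g : α → F} (hf : AEStronglyMeasurable f μ)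
    (hg : AEStronglyMeasurable g μ) (u v : Lp F q μ) :
    eLpNorm (fun x ↦ f x - g x - (u - v) x) q μ ≤
      eLpNorm (fun x ↦ f x - u x) q μ + eLpNorm (fun x ↦ g x - v x) q μ := by
  have h1 : eLpNorm (fun x ↦ f x - g x - (u - v) x) q μ =
      eLpNorm ((fun x ↦ f x - u x) - fun x ↦ g x - v x) q μ := by
    refine eLpNorm_congr_ae ?_
    filter_upwards [Lp.coeFn_sub u v] with x hx
    rw [hx, Pi.sub_apply, Pi.sub_apply]
    abel
  rw [h1]
  exact eLpNorm_sub_le (hf.sub (Lp.aestronglyMeasurable u)) (hg.sub (Lp.aestronglyMeasurable v))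
    Fact.out

theorem gradient_sub {f g : RSpace N → ℝ} (hf : ContDiff ℝ 1 f) (hg : ContDiff ℝ 1 g)
    (x : RSpace N) : gradient (fun x ↦ f x - g x) x = gradient f x - gradient g x := by
  rw [gradient, fderiv_fun_sub ((hf.differentiable one_ne_zero) x)
    ((hg.differentiable one_ne_zero) x), map_sub]
  rfl

variable [Fact (1 ≤ ENNReal.ofReal p)]

/-- The graph of the trace operator is closed in `W^{1,p}(Ω) × L^p(∂Ω)`. -/
theorem IsTrace.of_tendsto {u : ℕ → SobolevW Ω p}
    {w : ℕ → Lp ℝ (ENNReal.ofReal p) (surfaceMeasure Ω)} (h : ∀ n, IsTrace (u n) (w n))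
    {u' : SobolevW Ω p} {w' : Lp ℝ (ENNReal.ofReal p) (surfaceMeasure Ω)}
    (hu : Tendsto (fun n ↦ (u n).val) atTop (𝓝 u'.val))
    (hG : Tendsto (fun n ↦ (u n).grad) atTop (𝓝 u'.grad)) (hw : Tendsto w atTop (𝓝 w')) :
    IsTrace u' w' := by
  have hε : ∀ n : ℕ, (0 : ℝ≥0∞) < ((n : ℝ≥0∞) + 1)⁻¹ := fun n ↦ by simp
  have hex : ∀ n, ∃ f : RSpace N → ℝ, ContDiff ℝ 1 f ∧
      eLpNorm (fun x ↦ f x - (u n).val x) (ENNReal.ofReal p) (volume.restrict Ω)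
        ≤ ((n : ℝ≥0∞) + 1)⁻¹ ∧
      eLpNorm (fun x ↦ gradient f x - (u n).grad x) (ENNReal.ofReal p) (volume.restrict Ω)
        ≤ ((n : ℝ≥0∞) + 1)⁻¹ ∧
      eLpNorm (fun x ↦ f x - w n x) (ENNReal.ofReal p) (surfaceMeasure Ω)
        ≤ ((n : ℝ≥0∞) + 1)⁻¹ := by
    intro n
    obtain ⟨f, hf, f1, f2, f3⟩ := h n
    obtain ⟨k, h1, h2, h3⟩ := ((f1.eventually_le_const (hε n)).and
      ((f2.eventually_le_const (hε n)).and (f3.eventually_le_const (hε n)))).exists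
    exact ⟨f k, hf k, h1, h2, h3⟩
  choose f hf f1 f2 f3 using hex
  have h0 : Tendsto (fun n : ℕ ↦ ((n : ℝ≥0∞) + 1)⁻¹) atTop (𝓝 0) := by
    have := ENNReal.tendsto_inv_nat_nhds_zero.comp (tendsto_add_atTop_nat 1)
    simpa [Function.comp_def] using this
  have key : ∀ {F : Type} [NormedAddCommGroup F] {μ : Measure (RSpace N)}
      {k : ℕ → RSpace N → F} {v : ℕ → Lp F (ENNReal.ofReal p) μ} {v' : Lp F (ENNReal.ofReal p) μ},
      (∀ n, AEStronglyMeasurable (k n) μ) → Tendsto v atTop (𝓝 v') →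
      (∀ n, eLpNorm (fun x ↦ k n x - v n x) (ENNReal.ofReal p) μ ≤ ((n : ℝ≥0∞) + 1)⁻¹) →
      Tendsto (fun n ↦ eLpNorm (fun x ↦ k n x - v' x) (ENNReal.ofReal p) μ) atTop (𝓝 0) := by
    intro F _ μ k v v' hk hv hle
    have h1 := h0.add ((Lp.tendsto_Lp_iff_tendsto_eLpNorm' _ _).1 hv)
    rw [add_zero] at h1
    refine tendsto_of_tendsto_of_tendsto_of_le_of_le tendsto_const_nhds h1 (fun _ ↦ zero_le)
      fun n ↦ ?_
    have h2 : (fun x ↦ k n x - v' x) = (fun x ↦ k n x - v n x) + (⇑(v n) - ⇑v') := by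
      ext x; simp
    simp only [h2]
    exact (eLpNorm_add_le ((hk n).sub (Lp.aestronglyMeasurable _))
      ((Lp.aestronglyMeasurable _).sub (Lp.aestronglyMeasurable _)) Fact.out).trans
      (add_le_add (hle n) le_rfl)
  exact ⟨f, hf, key (fun n ↦ aestronglyMeasurable_of_contDiff (hf n) _) hu f1,
    key (fun n ↦ (continuous_gradient (hf n)).aestronglyMeasurable) hG f2,
    key (fun n ↦ aestronglyMeasurable_of_contDiff (hf n) _) hw f3⟩

variable [IsFiniteMeasure (volume.restrict Ω)]

theorem integrable_smul_gradient (u : Lp ℝ (ENNReal.ofReal p) (volume.restrict Ω))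
    {φ : RSpace N → ℝ} (hφ : ContDiff ℝ ∞ φ) (hc : HasCompactSupport φ) :
    Integrable (fun x ↦ u x • gradient φ x) (volume.restrict Ω) := by
  obtain ⟨C, -, hC⟩ := exists_bound_testFunction hφ hc
  refine (((Lp.memLp u).integrable Fact.out).norm.mul_const C).mono'
    ((Lp.aestronglyMeasurable u).smul
      (continuous_gradient (hφ.of_le (by simp))).aestronglyMeasurable)
    (Eventually.of_forall fun x ↦ ?_)
  rw [norm_smul]
  exact mul_le_mul_of_nonneg_left (hC x) (norm_nonneg _)

theorem integrable_testFunction_smul (G : Lp (RSpace N) (ENNReal.ofReal p) (volume.restrict Ω))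
    {φ : RSpace N → ℝ} (hφ : ContDiff ℝ ∞ φ) (hc : HasCompactSupport φ) :
    Integrable (fun x ↦ φ x • G x) (volume.restrict Ω) := by
  obtain ⟨C, hC, -⟩ := exists_bound_testFunction hφ hc
  refine (((Lp.memLp G).integrable Fact.out).norm.const_mul (C : ℝ)).mono'
    (hφ.continuous.aestronglyMeasurable.smul (Lp.aestronglyMeasurable G))
    (Eventually.of_forall fun x ↦ ?_)
  rw [norm_smul]
  exact mul_le_mul_of_nonneg_right (hC x) (norm_nonneg _)

theorem IsWeakGradient.sub {u v : Lp ℝ (ENNReal.ofReal p) (volume.restrict Ω)}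
    {G H : Lp (RSpace N) (ENNReal.ofReal p) (volume.restrict Ω)}
    (hu : IsWeakGradient Ω u G) (hv : IsWeakGradient Ω v H) :
    IsWeakGradient Ω ↑↑(u - v) ↑↑(G - H) := by
  intro φ hφ hc hs
  have h1 : ∫ x in Ω, (u - v) x • gradient φ x =
      ∫ x in Ω, (u x • gradient φ x - v x • gradient φ x) := by
    refine integral_congr_ae ?_
    filter_upwards [Lp.coeFn_sub u v] with x hx
    rw [hx, Pi.sub_apply, sub_smul]
  have h2 : ∫ x in Ω, φ x • (G - H) x = ∫ x in Ω, (φ x • G x - φ x • H x) := by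
    refine integral_congr_ae ?_
    filter_upwards [Lp.coeFn_sub G H] with x hx
    rw [hx, Pi.sub_apply, smul_sub]
  rw [h1, h2, integral_sub (integrable_smul_gradient u hφ hc) (integrable_smul_gradient v hφ hc),
    integral_sub (integrable_testFunction_smul G hφ hc) (integrable_testFunction_smul H hφ hc),
    hu φ hφ hc hs, hv φ hφ hc hs]
  abel

/-- The weak gradient is a closed operator. -/
theorem IsWeakGradient.of_tendsto {u : ℕ → Lp ℝ (ENNReal.ofReal p) (volume.restrict Ω)}
    {G : ℕ → Lp (RSpace N) (ENNReal.ofReal p) (volume.restrict Ω)}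
    (h : ∀ n, IsWeakGradient Ω (u n) (G n)) {u' : Lp ℝ (ENNReal.ofReal p) (volume.restrict Ω)}
    {G' : Lp (RSpace N) (ENNReal.ofReal p) (volume.restrict Ω)}
    (hu : Tendsto u atTop (𝓝 u')) (hG : Tendsto G atTop (𝓝 G')) :
    IsWeakGradient Ω u' G' := by
  intro φ hφ hc hs
  obtain ⟨C, hC, hC'⟩ := exists_bound_testFunction hφ hc
  have h1 := tendsto_integral_of_norm_sub_le hu (fun n ↦ integrable_smul_gradient (u n) hφ hc)
    (integrable_smul_gradient u' hφ hc) (C := C) fun n x ↦ by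
      rw [← sub_smul, norm_smul, mul_comm]
      exact mul_le_mul_of_nonneg_right (hC' x) (norm_nonneg _)
  have h2 := tendsto_integral_of_norm_sub_le hG (fun n ↦ integrable_testFunction_smul (G n) hφ hc)
    (integrable_testFunction_smul G' hφ hc) (C := C) fun n x ↦ by
      rw [← smul_sub, norm_smul]
      exact mul_le_mul_of_nonneg_right (hC x) (norm_nonneg _)
  exact tendsto_nhds_unique (h1.congr fun n ↦ h n φ hφ hc hs) h2.neg

/-- The difference of two Sobolev functions. -/
noncomputable def SobolevW.sub (u v : SobolevW Ω p) : SobolevW Ω p :=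
  ⟨u.val - v.val, u.grad - v.grad, u.isWeakGradient.sub v.isWeakGradient⟩

theorem IsTrace.sub {u v : SobolevW Ω p} {w w' : Lp ℝ (ENNReal.ofReal p) (surfaceMeasure Ω)}
    (hu : IsTrace u w) (hv : IsTrace v w') : IsTrace (u.sub v) (w - w') := by
  obtain ⟨f, hf, f1, f2, f3⟩ := hu
  obtain ⟨g, hg, g1, g2, g3⟩ := hv
  refine ⟨fun n x ↦ f n x - g n x, fun n ↦ (hf n).sub (hg n), ?_, ?_, ?_⟩
  · refine tendsto_of_tendsto_of_tendsto_of_le_of_le tendsto_const_nhds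
      (by simpa using f1.add g1) (fun _ ↦ zero_le) fun n ↦ ?_
    exact eLpNorm_sub_sub_sub_le (aestronglyMeasurable_of_contDiff (hf n) _)
      (aestronglyMeasurable_of_contDiff (hg n) _) u.val v.val
  · refine tendsto_of_tendsto_of_tendsto_of_le_of_le tendsto_const_nhds
      (by simpa using f2.add g2) (fun _ ↦ zero_le) fun n ↦ ?_
    simp only [gradient_sub (hf n) (hg n)]
    exact eLpNorm_sub_sub_sub_le (continuous_gradient (hf n)).aestronglyMeasurable
      (continuous_gradient (hg n)).aestronglyMeasurable u.grad v.grad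
  · refine tendsto_of_tendsto_of_tendsto_of_le_of_le tendsto_const_nhds
      (by simpa using f3.add g3) (fun _ ↦ zero_le) fun n ↦ ?_
    exact eLpNorm_sub_sub_sub_le (aestronglyMeasurable_of_contDiff (hf n) _)
      (aestronglyMeasurable_of_contDiff (hg n) _) w w'

/-- The trace operator preserves the order. -/
theorem IsTrace.mono (hN : 1 ≤ N) (hΩ : IsBoundedC2Domain Ω) (hp : 1 < p)
    {u v : SobolevW Ω p} {w w' : Lp ℝ (ENNReal.ofReal p) (surfaceMeasure Ω)}
    (hu : IsTrace u w) (hv : IsTrace v w') (huv : u ≤ v) : w ≤ w' := by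
  have h1 : ∀ᵐ x ∂(volume.restrict Ω), (u.sub v).val x ≤ 0 := by
    filter_upwards [(SobolevW.le_iff u v).1 huv, Lp.coeFn_sub u.val v.val] with x hx hx'
    rw [SobolevW.sub, hx', Pi.sub_apply]
    linarith
  rw [← Lp.coeFn_le]
  filter_upwards [(hu.sub hv).ae_le_const hN hΩ hp h1, Lp.coeFn_sub w w'] with x hx hx'
  rw [hx', Pi.sub_apply] at hx
  linarith

/-- The weak formulation tested with a difference. -/
theorem SolvesBoundaryProblem.eq_sub (hp : 1 < p) {u v v' : SobolevW Ω p} {b : RSpace N → ℝ}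
    {ψ ψ' : Lp ℝ (ENNReal.ofReal p) (surfaceMeasure Ω)}
    (h : SolvesBoundaryProblem u b) (hv : IsTrace v ψ) (hv' : IsTrace v' ψ') :
    (∫ x in Ω, pPairing p (u.grad x) (v.grad x - v'.grad x)) +
        (∫ x in Ω, pPairing p (u.val x) (v.val x - v'.val x))
      = ∫ x, b x * (ψ x - ψ' x) ∂(surfaceMeasure Ω) := by
  have h1 := ((solvesBoundaryProblem_iff hp).1 h _ _ (hv.sub hv')).2
  have e1 : ∫ x in Ω, pPairing p (u.grad x) ((v.sub v').grad x) =
      ∫ x in Ω, pPairing p (u.grad x) (v.grad x - v'.grad x) := by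
    refine integral_congr_ae ?_
    filter_upwards [Lp.coeFn_sub v.grad v'.grad] with x hx
    rw [SobolevW.sub, hx, Pi.sub_apply]
  have e2 : ∫ x in Ω, pPairing p (u.val x) ((v.sub v').val x) =
      ∫ x in Ω, pPairing p (u.val x) (v.val x - v'.val x) := by
    refine integral_congr_ae ?_
    filter_upwards [Lp.coeFn_sub v.val v'.val] with x hx
    rw [SobolevW.sub, hx, Pi.sub_apply]
  have e3 : ∫ x, b x * (ψ - ψ') x ∂(surfaceMeasure Ω) =
      ∫ x, b x * (ψ x - ψ' x) ∂(surfaceMeasure Ω) := by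
    refine integral_congr_ae ?_
    filter_upwards [Lp.coeFn_sub ψ ψ'] with x hx
    rw [hx, Pi.sub_apply]
  rwa [e1, e2, e3] at h1

end SobolevClosure

section LimitSolution

variable {N : ℕ} {Ω : Set (RSpace N)} {p : ℝ}
  [IsFiniteMeasure (volume.restrict Ω)] [IsFiniteMeasure (surfaceMeasure Ω)]
  [Fact (1 ≤ ENNReal.ofReal p)]

/-- If bounded solutions have bounded boundary data and traces that converge in `L^p(∂Ω)`, then
their gradients are a Cauchy sequence. Subtracting the equations of two solutions, tested with their
difference, bounds the monotone gradient term by the `L¹(∂Ω)` distance of the traces; the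
zeroth order term has a sign and is dropped. -/
theorem cauchySeq_grad_of_solves (hp : 1 < p) {u : ℕ → SobolevW Ω p}
    {w : ℕ → Lp ℝ (ENNReal.ofReal p) (surfaceMeasure Ω)} (hw : ∀ n, IsTrace (u n) (w n))
    {b : ℕ → RSpace N → ℝ} (hb : ∀ n, SolvesBoundaryProblem (u n) (b n)) {M B : ℝ} (hB : 0 ≤ B)
    (hwM : ∀ n, ∀ᵐ x ∂(surfaceMeasure Ω), |w n x| ≤ M)
    (hbB : ∀ n, ∀ᵐ x ∂(surfaceMeasure Ω), |b n x| ≤ B)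
    {w' : Lp ℝ (ENNReal.ofReal p) (surfaceMeasure Ω)} (hw' : Tendsto w atTop (𝓝 w')) :
    CauchySeq fun n ↦ (u n).grad := by
  have hint : ∀ v : Lp ℝ (ENNReal.ofReal p) (surfaceMeasure Ω), Integrable v (surfaceMeasure Ω) :=
    fun v ↦ (Lp.memLp v).integrable Fact.out
  have hL1 : Tendsto (fun n ↦ ∫ x, |w n x - w' x| ∂(surfaceMeasure Ω)) atTop (𝓝 0) := by
    have := tendsto_integral_of_norm_sub_le hw' (h := fun n x ↦ |w n x - w' x|)
      (h' := fun _ ↦ (0 : ℝ)) (C := 1) (fun n ↦ ((hint _).sub (hint _)).abs)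
      (integrable_zero _ _ _) (fun n x ↦ by simp)
    simpa using this
  refine Lp.cauchySeq_of_pPairing hp (K := ∫ _, B * M ∂(surfaceMeasure Ω)) (fun n ↦ ?_)
    fun ε hε ↦ ?_
  · -- Testing with the solution itself bounds its gradient.
    have h1 := ((solvesBoundaryProblem_iff hp).1 (hb n) _ _ (hw n))
    simp only [pPairing_self hp, Lp.integral_norm_rpow_eq hp] at h1
    have h2 : 0 ≤ ‖(u n).val‖ ^ p := by positivity
    have h3 : ∫ x, b n x * w n x ∂(surfaceMeasure Ω) ≤ ∫ _, B * M ∂(surfaceMeasure Ω) := by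
      refine integral_mono_ae h1.1 (integrable_const _) ?_
      filter_upwards [hwM n, hbB n] with x hx hx'
      calc b n x * w n x ≤ |b n x * w n x| := le_abs_self _
        _ = |b n x| * |w n x| := abs_mul _ _
        _ ≤ B * M := by gcongr
    linarith [h1.2]
  · obtain ⟨n₀, hn₀⟩ := eventually_atTop.1
      (hL1.eventually_le_const (by positivity : 0 < ε / (4 * (B + 1))))
    refine ⟨n₀, fun m hm n hn ↦ ?_⟩
    have h1 := (hb m).eq_sub hp (hw m) (hw n)
    have h2 := (hb n).eq_sub hp (hw m) (hw n)
    have h3 : (∫ x in Ω, pPairing p ((u n).val x) ((u m).val x - (u n).val x)) ≤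
        ∫ x in Ω, pPairing p ((u m).val x) ((u m).val x - (u n).val x) :=
      integral_mono (Lp.integrable_pPairing_sub hp _ _ _) (Lp.integrable_pPairing_sub hp _ _ _)
        fun x ↦ sub_nonneg.1 (pPairing_sub_nonneg hp _ _)
    have hd : ∀ k, Integrable (fun x ↦ |w k x - w' x|) (surfaceMeasure Ω) :=
      fun k ↦ ((hint _).sub (hint _)).abs
    have hbd : ∀ k, |∫ x, b k x * (w m x - w n x) ∂(surfaceMeasure Ω)| ≤ ε / 2 := by
      intro k
      have h4 : Integrable (fun x ↦ B * (|w m x - w' x| + |w n x - w' x|)) (surfaceMeasure Ω) :=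
        ((hd m).add (hd n)).const_mul B
      have h5 := norm_integral_le_of_norm_le (f := fun x ↦ b k x * (w m x - w n x)) h4 (by
        filter_upwards [hbB k] with x hx
        rw [norm_mul]
        gcongr
        · exact hx
        · rw [Real.norm_eq_abs, abs_sub_comm (w n x) (w' x)]
          exact abs_sub_le _ _ _)
      rw [Real.norm_eq_abs, integral_const_mul,
        integral_add (hd m) (hd n)] at h5
      refine h5.trans ?_
      calc _ ≤ B * (ε / (4 * (B + 1)) + ε / (4 * (B + 1))) := by
            gcongr
            · exact hn₀ m hm
            · exact hn₀ n hn
        _ ≤ (B + 1) * (ε / (4 * (B + 1)) + ε / (4 * (B + 1))) := by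
            gcongr; linarith
        _ = ε / 2 := by field_simp; norm_num
    have h6 := (abs_le.1 (hbd m)).2
    have h7 := (abs_le.1 (hbd n)).1
    linarith

/-- Weak solutions are stable under convergence of the functions, the traces and the data. -/
theorem exists_solvesBoundaryProblem_of_tendsto (hp : 1 < p) {u : ℕ → SobolevW Ω p}
    {w : ℕ → Lp ℝ (ENNReal.ofReal p) (surfaceMeasure Ω)} (hw : ∀ n, IsTrace (u n) (w n))
    {b : ℕ → RSpace N → ℝ} (hb : ∀ n, SolvesBoundaryProblem (u n) (b n)) {M B : ℝ} (hB : 0 ≤ B)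
    (hwM : ∀ n, ∀ᵐ x ∂(surfaceMeasure Ω), |w n x| ≤ M)
    (hbB : ∀ n, ∀ᵐ x ∂(surfaceMeasure Ω), |b n x| ≤ B)
    {w' : Lp ℝ (ENNReal.ofReal p) (surfaceMeasure Ω)} (hw' : Tendsto w atTop (𝓝 w'))
    {b' : RSpace N → ℝ}
    (hb' : ∀ᵐ x ∂(surfaceMeasure Ω), Tendsto (fun n ↦ b n x) atTop (𝓝 (b' x)))
    {U : Lp ℝ (ENNReal.ofReal p) (volume.restrict Ω)}
    (hU : Tendsto (fun n ↦ (u n).val) atTop (𝓝 U)) :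
    ∃ u' : SobolevW Ω p, u'.val = U ∧ IsTrace u' w' ∧ SolvesBoundaryProblem u' b' := by
  obtain ⟨G, hG⟩ := cauchySeq_tendsto_of_complete
    (cauchySeq_grad_of_solves hp hw hb hB hwM hbB hw')
  refine ⟨⟨U, G, IsWeakGradient.of_tendsto (fun n ↦ (u n).isWeakGradient) hU hG⟩, rfl,
    IsTrace.of_tendsto hw hU hG hw', (solvesBoundaryProblem_iff hp).2 fun φ ψ hφ ↦ ?_⟩
  have hsol := fun n ↦ (solvesBoundaryProblem_iff hp).1 (hb n) φ ψ hφ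
  have hψ : Integrable ψ (surfaceMeasure Ω) := (Lp.memLp ψ).integrable Fact.out
  have hlim : ∀ᵐ x ∂(surfaceMeasure Ω), Tendsto (fun n ↦ b n x * ψ x) atTop (𝓝 (b' x * ψ x)) := by
    filter_upwards [hb'] with x hx using hx.mul_const _
  have hdom : ∀ n, ∀ᵐ x ∂(surfaceMeasure Ω), ‖b n x * ψ x‖ ≤ B * ‖ψ x‖ := fun n ↦ by
    filter_upwards [hbB n] with x hx
    rw [norm_mul]
    gcongr
    exact hx
  have hint : Integrable (fun x ↦ b' x * ψ x) (surfaceMeasure Ω) := by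
    refine (hψ.norm.const_mul B).mono'
      (aestronglyMeasurable_of_tendsto_ae atTop (fun n ↦ (hsol n).1.1) hlim) ?_
    filter_upwards [hlim, ae_all_iff.2 hdom] with x h1 h2
    exact le_of_tendsto' h1.norm h2
  have hbdry := tendsto_integral_of_dominated_convergence (fun x ↦ B * ‖ψ x‖)
    (fun n ↦ (hsol n).1.1) (hψ.norm.const_mul B) hdom hlim
  have hgrad := Lp.tendsto_integral_pPairing hp hG φ.grad
  have hval := Lp.tendsto_integral_pPairing hp hU φ.val
  exact ⟨hint, tendsto_nhds_unique (hgrad.add hval) (hbdry.congr fun n ↦ ((hsol n).2).symm)⟩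

end LimitSolution

/-! ### An ordering principle -/

section Order

variable {α : Type*} [Preorder α] {S : α → Prop} {F : α → ℝ}

/-- The ordering principle of Brezis and Browder: if a strictly monotone functional is bounded below
on `S` and decreasing sequences in `S` have lower bounds in `S`, then there are minimal elements
below each element of `S`. Along a decreasing sequence whose `n`-th step comes within `1 / (n + 1)`
of the infimum of the functional below its predecessor, any lower bound is minimal. -/
theorem exists_minimal_of_antitone_seq
    (hF : ∀ a b, S a → S b → a ≤ b → F b ≤ F a → b ≤ a) {c : ℝ} (hc : ∀ a, S a → c ≤ F a)
    (hmono : ∀ a b, S a → S b → a ≤ b → F a ≤ F b)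
    (hseq : ∀ u : ℕ → α, Antitone u → (∀ n, S (u n)) → ∃ m, S m ∧ ∀ n, m ≤ u n)
    {x : α} (hx : S x) : ∃ m ≤ x, Minimal S m := by
  have hstep : ∀ (n : ℕ) (a : {a // S a}), ∃ b : {a // S a}, b.1 ≤ a.1 ∧
      ∀ y, S y → y ≤ a.1 → F b.1 ≤ F y + 1 / ((n : ℝ) + 1) := by
    intro n a
    set V : Set ℝ := F '' {y | S y ∧ y ≤ a.1}
    have hV : V.Nonempty := ⟨F a.1, a.1, ⟨a.2, le_rfl⟩, rfl⟩
    have hVb : BddBelow V := ⟨c, by rintro _ ⟨y, hy, rfl⟩; exact hc y hy.1⟩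
    obtain ⟨_, ⟨b, hb, rfl⟩, hlt⟩ := exists_lt_of_csInf_lt hV
      (lt_add_of_pos_right (sInf V) (by positivity : 0 < 1 / ((n : ℝ) + 1)))
    refine ⟨⟨b, hb.1⟩, hb.2, fun y hy hya ↦ ?_⟩
    have := csInf_le hVb ⟨y, ⟨hy, hya⟩, rfl⟩
    simp only
    linarith
  choose next hnext hnext' using hstep
  let u : ℕ → {a // S a} := fun n ↦ Nat.rec ⟨x, hx⟩ (fun n a ↦ next n a) n
  have hu : ∀ n, u (n + 1) = next n (u n) := fun n ↦ rfl
  obtain ⟨m, hm, hmu⟩ := hseq (fun n ↦ (u n).1)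
    (antitone_nat_of_succ_le fun n ↦ by rw [hu]; exact hnext n _) fun n ↦ (u n).2
  refine ⟨m, hmu 0, hm, fun y hy hym ↦ hF y m hy hm hym ?_⟩
  refine le_of_forall_pos_le_add fun δ hδ ↦ ?_
  obtain ⟨n, hn⟩ := exists_nat_one_div_lt hδ
  have h1 := hnext' n (u n) y hy (hym.trans (hmu n))
  have h2 := hmono _ _ hm (u (n + 1)).2 (hmu (n + 1))
  rw [hu] at h2
  linarith

theorem exists_maximal_of_monotone_seq
    (hF : ∀ a b, S a → S b → a ≤ b → F b ≤ F a → b ≤ a) {c : ℝ} (hc : ∀ a, S a → F a ≤ c)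
    (hmono : ∀ a b, S a → S b → a ≤ b → F a ≤ F b)
    (hseq : ∀ u : ℕ → α, Monotone u → (∀ n, S (u n)) → ∃ m, S m ∧ ∀ n, u n ≤ m)
    {x : α} (hx : S x) : ∃ m, x ≤ m ∧ Maximal S m := by
  obtain ⟨m, hmx, hm, hmin⟩ := exists_minimal_of_antitone_seq (α := αᵒᵈ)
    (S := fun a ↦ S (OrderDual.ofDual a)) (F := fun a ↦ -F (OrderDual.ofDual a)) (c := -c)
    (fun a b ha hb hab h ↦
      OrderDual.ofDual_le_ofDual.1 (hF _ _ hb ha (OrderDual.ofDual_le_ofDual.2 hab)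
        (neg_le_neg_iff.1 h)))
    (fun a ha ↦ neg_le_neg (hc _ ha))
    (fun a b ha hb hab ↦ neg_le_neg (hmono _ _ hb ha (OrderDual.ofDual_le_ofDual.2 hab)))
    (fun u hu hS ↦ by
      obtain ⟨m, hm, hle⟩ := hseq (fun n ↦ OrderDual.ofDual (u n))
        (fun i j hij ↦ OrderDual.ofDual_le_ofDual.2 (hu hij)) hS
      exact ⟨OrderDual.toDual m, hm, hle⟩)
    (x := OrderDual.toDual x) hx
  exact ⟨OrderDual.ofDual m, hmx, hm, fun y hy h ↦ hmin (y := OrderDual.toDual y) hy h⟩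

end Order

/-! ### Monotone limits of solutions and extremal solutions -/

section ExtremalSolutions

variable {N : ℕ} {Ω : Set (RSpace N)} {p₁ p₂ : ℝ}

/-- On a bounded set of arguments the nonlinearity is bounded by one constant. -/
theorem HypothesisH0.exists_bound {g : RSpace N → ℝ → ℝ → ℝ} (h : HypothesisH0 Ω g) (M : ℝ) :
    ∃ B, 0 ≤ B ∧ ∀ᵐ x ∂(surfaceMeasure Ω), ∀ s t, |s| ≤ M → |t| ≤ M → |g x s t| ≤ B := by
  obtain ⟨H, hH, hb⟩ := h.bounded (Icc (-M) M ×ˢ Icc (-M) M)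
    ((Metric.isBounded_Icc _ _).prod (Metric.isBounded_Icc _ _))
  refine ⟨(eLpNormEssSup H (surfaceMeasure Ω)).toReal, ENNReal.toReal_nonneg, ?_⟩
  have hfin : eLpNormEssSup H (surfaceMeasure Ω) ≠ ⊤ := by
    rw [← eLpNorm_exponent_top]
    exact hH.2.ne
  filter_upwards [hb, ae_le_eLpNormEssSup (f := H) (μ := surfaceMeasure Ω)] with x hx hx' s t hs ht
  refine (hx (s, t) ⟨abs_le.1 hs, abs_le.1 ht⟩).trans ((le_abs_self _).trans ?_)
  have := ENNReal.toReal_mono hfin hx'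
  rwa [toReal_enorm] at this

/-- Weak solutions are stable under bounded monotone limits. -/
theorem exists_isWeakSolution_of_monotone (hN : 1 ≤ N) (hΩ : IsBoundedC2Domain Ω)
    [IsFiniteMeasure (volume.restrict Ω)] [IsFiniteMeasure (surfaceMeasure Ω)]
    [Fact (1 ≤ ENNReal.ofReal p₁)] [Fact (1 ≤ ENNReal.ofReal p₂)]
    (hp₁ : 1 < p₁) (hp₂ : 1 < p₂) {g₁ g₂ : RSpace N → ℝ → ℝ → ℝ}
    (h0₁ : HypothesisH0 Ω g₁) (h0₂ : HypothesisH0 Ω g₂)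
    {u : ℕ → SobolevW Ω p₁ × SobolevW Ω p₂} (hu : Monotone u ∨ Antitone u)
    (hsol : ∀ n, IsWeakSolution g₁ g₂ (u n)) {M : ℝ}
    (hM₁ : ∀ n, ∀ᵐ x ∂(volume.restrict Ω), |(u n).1.val x| ≤ M)
    (hM₂ : ∀ n, ∀ᵐ x ∂(volume.restrict Ω), |(u n).2.val x| ≤ M) :
    ∃ m : SobolevW Ω p₁ × SobolevW Ω p₂, IsWeakSolution g₁ g₂ m ∧
      (∀ᵐ x ∂(volume.restrict Ω), Tendsto (fun n ↦ (u n).1.val x) atTop (𝓝 (m.1.val x))) ∧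
      ∀ᵐ x ∂(volume.restrict Ω), Tendsto (fun n ↦ (u n).2.val x) atTop (𝓝 (m.2.val x)) := by
  choose w₁ w₂ ht₁ ht₂ hs₁ hs₂ using hsol
  have hw₁M : ∀ n, ∀ᵐ x ∂(surfaceMeasure Ω), |w₁ n x| ≤ M := fun n ↦ by
    filter_upwards [(ht₁ n).ae_le_const hN hΩ hp₁ ((hM₁ n).mono fun x hx ↦ (abs_le.1 hx).2),
      (ht₁ n).ae_const_le hN hΩ hp₁ ((hM₁ n).mono fun x hx ↦ (abs_le.1 hx).1)] with x h1 h2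
    exact abs_le.2 ⟨h2, h1⟩
  have hw₂M : ∀ n, ∀ᵐ x ∂(surfaceMeasure Ω), |w₂ n x| ≤ M := fun n ↦ by
    filter_upwards [(ht₂ n).ae_le_const hN hΩ hp₂ ((hM₂ n).mono fun x hx ↦ (abs_le.1 hx).2),
      (ht₂ n).ae_const_le hN hΩ hp₂ ((hM₂ n).mono fun x hx ↦ (abs_le.1 hx).1)] with x h1 h2
    exact abs_le.2 ⟨h2, h1⟩
  have hw₁ : Monotone w₁ ∨ Antitone w₁ :=
    hu.imp (fun h i j hij ↦ (ht₁ i).mono hN hΩ hp₁ (ht₁ j) (h hij).1)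
      (fun h i j hij ↦ (ht₁ j).mono hN hΩ hp₁ (ht₁ i) (h hij).1)
  have hw₂ : Monotone w₂ ∨ Antitone w₂ :=
    hu.imp (fun h i j hij ↦ (ht₂ i).mono hN hΩ hp₂ (ht₂ j) (h hij).2)
      (fun h i j hij ↦ (ht₂ j).mono hN hΩ hp₂ (ht₂ i) (h hij).2)
  obtain ⟨w₁', hl₁, ha₁⟩ := Lp.exists_tendsto_of_monotone hp₁ hw₁ hw₁M
  obtain ⟨w₂', hl₂, ha₂⟩ := Lp.exists_tendsto_of_monotone hp₂ hw₂ hw₂M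
  obtain ⟨U₁, hU₁, hUa₁⟩ := Lp.exists_tendsto_of_monotone hp₁ (F := fun n ↦ (u n).1.val)
    (hu.imp (fun h i j hij ↦ (h hij).1) fun h i j hij ↦ (h hij).1) hM₁
  obtain ⟨U₂, hU₂, hUa₂⟩ := Lp.exists_tendsto_of_monotone hp₂ (F := fun n ↦ (u n).2.val)
    (hu.imp (fun h i j hij ↦ (h hij).2) fun h i j hij ↦ (h hij).2) hM₂
  obtain ⟨B₁, hB₁, hb₁⟩ := h0₁.exists_bound M
  obtain ⟨B₂, hB₂, hb₂⟩ := h0₂.exists_bound M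
  obtain ⟨m₁, hm₁, hmt₁, hms₁⟩ := exists_solvesBoundaryProblem_of_tendsto hp₁ ht₁ hs₁ hB₁ hw₁M
    (fun n ↦ by
      filter_upwards [hb₁, hw₁M n, hw₂M n] with x h1 h2 h3 using h1 _ _ h2 h3)
    hl₁ (b' := fun x ↦ g₁ x (w₁' x) (w₂' x)) (by
      filter_upwards [h0₁.continuous, ha₁, ha₂] with x h1 h2 h3
      exact (h1.tendsto (w₁' x, w₂' x)).comp (h2.prodMk_nhds h3)) hU₁
  obtain ⟨m₂, hm₂, hmt₂, hms₂⟩ := exists_solvesBoundaryProblem_of_tendsto hp₂ ht₂ hs₂ hB₂ hw₂M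
    (fun n ↦ by
      filter_upwards [hb₂, hw₁M n, hw₂M n] with x h1 h2 h3 using h1 _ _ h2 h3)
    hl₂ (b' := fun x ↦ g₂ x (w₁' x) (w₂' x)) (by
      filter_upwards [h0₂.continuous, ha₁, ha₂] with x h1 h2 h3
      exact (h1.tendsto (w₁' x, w₂' x)).comp (h2.prodMk_nhds h3)) hU₂
  refine ⟨(m₁, m₂), ⟨w₁', w₂', hmt₁, hmt₂, hms₁, hms₂⟩, ?_, ?_⟩
  · rw [hm₁]; exact hUa₁
  · rw [hm₂]; exact hUa₂

/-- The sum of the integrals of the two components, a strictly monotone functional on pairs. -/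
noncomputable def totalIntegral (h : SobolevW Ω p₁ × SobolevW Ω p₂) : ℝ :=
  (∫ x in Ω, h.1.val x) + ∫ x in Ω, h.2.val x

theorem SobolevW.integrable [IsFiniteMeasure (volume.restrict Ω)] [Fact (1 ≤ ENNReal.ofReal p₁)]
    (u : SobolevW Ω p₁) : Integrable u.val (volume.restrict Ω) :=
  (Lp.memLp u.val).integrable Fact.out

theorem SobolevW.integral_mono [IsFiniteMeasure (volume.restrict Ω)]
    [Fact (1 ≤ ENNReal.ofReal p₁)] {u v : SobolevW Ω p₁} (h : u ≤ v) :
    ∫ x in Ω, u.val x ≤ ∫ x in Ω, v.val x :=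
  integral_mono_ae u.integrable v.integrable ((SobolevW.le_iff u v).1 h)

theorem SobolevW.ge_of_integral_le [IsFiniteMeasure (volume.restrict Ω)]
    [Fact (1 ≤ ENNReal.ofReal p₁)] {u v : SobolevW Ω p₁} (h : u ≤ v)
    (hi : ∫ x in Ω, v.val x ≤ ∫ x in Ω, u.val x) : v ≤ u := by
  have h1 := (integral_eq_iff_of_ae_le u.integrable v.integrable ((SobolevW.le_iff u v).1 h)).1
    (le_antisymm (SobolevW.integral_mono h) hi)
  rw [SobolevW.le_iff]
  filter_upwards [h1] with x hx using hx.ge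

theorem totalIntegral_mono [IsFiniteMeasure (volume.restrict Ω)]
    [Fact (1 ≤ ENNReal.ofReal p₁)] [Fact (1 ≤ ENNReal.ofReal p₂)]
    {u v : SobolevW Ω p₁ × SobolevW Ω p₂} (h : u ≤ v) : totalIntegral u ≤ totalIntegral v :=
  add_le_add (SobolevW.integral_mono h.1) (SobolevW.integral_mono h.2)

theorem ge_of_totalIntegral_le [IsFiniteMeasure (volume.restrict Ω)]
    [Fact (1 ≤ ENNReal.ofReal p₁)] [Fact (1 ≤ ENNReal.ofReal p₂)]
    {u v : SobolevW Ω p₁ × SobolevW Ω p₂} (h : u ≤ v)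
    (hi : totalIntegral v ≤ totalIntegral u) : v ≤ u := by
  have h1 := SobolevW.integral_mono h.1
  have h2 := SobolevW.integral_mono h.2
  unfold totalIntegral at hi
  exact ⟨SobolevW.ge_of_integral_le h.1 (by linarith),
    SobolevW.ge_of_integral_le h.2 (by linarith)⟩

theorem abs_totalIntegral_le [IsFiniteMeasure (volume.restrict Ω)]
    {u : SobolevW Ω p₁ × SobolevW Ω p₂} {M : ℝ}
    (hM₁ : ∀ᵐ x ∂(volume.restrict Ω), |u.1.val x| ≤ M)
    (hM₂ : ∀ᵐ x ∂(volume.restrict Ω), |u.2.val x| ≤ M) :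
    |totalIntegral u| ≤ M * (volume.restrict Ω).real univ + M * (volume.restrict Ω).real univ :=
  (abs_add_le _ _).trans (add_le_add
    (norm_integral_le_of_norm_le_const (f := u.1.val) hM₁)
    (norm_integral_le_of_norm_le_const (f := u.2.val) hM₂))

/-- Every solution in a bounded order rectangle lies between a minimal and a maximal one. -/
theorem exists_extremal_isWeakSolution (hN : 1 ≤ N) (hΩ : IsBoundedC2Domain Ω)
    (hp₁ : 1 < p₁) (hp₂ : 1 < p₂) {g₁ g₂ : RSpace N → ℝ → ℝ → ℝ}
    (h0₁ : HypothesisH0 Ω g₁) (h0₂ : HypothesisH0 Ω g₂) {a₁ b₁ a₂ b₂ : RSpace N → ℝ} {M : ℝ}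
    (h₁ : ∀ᵐ x ∂(volume.restrict Ω), -M ≤ a₁ x ∧ b₁ x ≤ M)
    (h₂ : ∀ᵐ x ∂(volume.restrict Ω), -M ≤ a₂ x ∧ b₂ x ≤ M)
    {u : SobolevW Ω p₁ × SobolevW Ω p₂} (hu : IsWeakSolution g₁ g₂ u)
    (hR : u ∈ sobolevInterval Ω p₁ a₁ b₁ ×ˢ sobolevInterval Ω p₂ a₂ b₂) :
    (∃ m ≤ u, Minimal (fun h ↦ IsWeakSolution g₁ g₂ h ∧
      h ∈ sobolevInterval Ω p₁ a₁ b₁ ×ˢ sobolevInterval Ω p₂ a₂ b₂) m) ∧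
    ∃ m, u ≤ m ∧ Maximal (fun h ↦ IsWeakSolution g₁ g₂ h ∧
      h ∈ sobolevInterval Ω p₁ a₁ b₁ ×ˢ sobolevInterval Ω p₂ a₂ b₂) m := by
  have : IsFiniteMeasure (surfaceMeasure Ω) := isFiniteMeasure_surfaceMeasure hN hΩ
  have : IsFiniteMeasure (volume.restrict Ω) :=
    ⟨by rw [Measure.restrict_apply_univ]; exact hΩ.isBounded.measure_lt_top⟩
  have : Fact (1 ≤ ENNReal.ofReal p₁) := ⟨one_le_ofReal hp₁⟩
  have : Fact (1 ≤ ENNReal.ofReal p₂) := ⟨one_le_ofReal hp₂⟩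
  set S : SobolevW Ω p₁ × SobolevW Ω p₂ → Prop := fun h ↦ IsWeakSolution g₁ g₂ h ∧
    h ∈ sobolevInterval Ω p₁ a₁ b₁ ×ˢ sobolevInterval Ω p₂ a₂ b₂
  have hM₁ : ∀ h, S h → ∀ᵐ x ∂(volume.restrict Ω), |h.1.val x| ≤ M := fun h hh ↦ by
    filter_upwards [h₁, hh.2.1] with x hx hx'
    exact abs_le.2 ⟨hx.1.trans hx'.1, hx'.2.trans hx.2⟩
  have hM₂ : ∀ h, S h → ∀ᵐ x ∂(volume.restrict Ω), |h.2.val x| ≤ M := fun h hh ↦ by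
    filter_upwards [h₂, hh.2.2] with x hx hx'
    exact abs_le.2 ⟨hx.1.trans hx'.1, hx'.2.trans hx.2⟩
  have hlim : ∀ u : ℕ → SobolevW Ω p₁ × SobolevW Ω p₂, Monotone u ∨ Antitone u →
      (∀ n, S (u n)) → ∃ m, S m ∧
        (∀ᵐ x ∂(volume.restrict Ω), Tendsto (fun n ↦ (u n).1.val x) atTop (𝓝 (m.1.val x))) ∧
        ∀ᵐ x ∂(volume.restrict Ω), Tendsto (fun n ↦ (u n).2.val x) atTop (𝓝 (m.2.val x)) := by
    intro u hu hS
    obtain ⟨m, hm, h1, h2⟩ := exists_isWeakSolution_of_monotone hN hΩ hp₁ hp₂ h0₁ h0₂ hu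
      (fun n ↦ (hS n).1) (fun n ↦ hM₁ _ (hS n)) (fun n ↦ hM₂ _ (hS n))
    refine ⟨m, ⟨hm, ?_, ?_⟩, h1, h2⟩
    · have h3 : ∀ᵐ x ∂(volume.restrict Ω), ∀ n, a₁ x ≤ (u n).1.val x ∧ (u n).1.val x ≤ b₁ x :=
        ae_all_iff.2 fun n ↦ (hS n).2.1
      filter_upwards [h1, h3] with x hx hx'
      exact ⟨ge_of_tendsto' hx fun n ↦ (hx' n).1, le_of_tendsto' hx fun n ↦ (hx' n).2⟩
    · have h3 : ∀ᵐ x ∂(volume.restrict Ω), ∀ n, a₂ x ≤ (u n).2.val x ∧ (u n).2.val x ≤ b₂ x :=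
        ae_all_iff.2 fun n ↦ (hS n).2.2
      filter_upwards [h2, h3] with x hx hx'
      exact ⟨ge_of_tendsto' hx fun n ↦ (hx' n).1, le_of_tendsto' hx fun n ↦ (hx' n).2⟩
  have hle : ∀ {p : ℝ} {v : ℕ → SobolevW Ω p} {m : SobolevW Ω p}, Monotone v →
      (∀ᵐ x ∂(volume.restrict Ω), Tendsto (fun n ↦ (v n).val x) atTop (𝓝 (m.val x))) →
      ∀ n, v n ≤ m := by
    intro p v m hv hm n
    have h3 : ∀ᵐ x ∂(volume.restrict Ω), ∀ k, (v k).val x ≤ (v (k + 1)).val x :=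
      ae_all_iff.2 fun k ↦ (SobolevW.le_iff _ _).1 (hv k.le_succ)
    rw [SobolevW.le_iff]
    filter_upwards [hm, h3] with x hx hx'
    exact (monotone_nat_of_le_succ hx').ge_of_tendsto hx n
  have hge : ∀ {p : ℝ} {v : ℕ → SobolevW Ω p} {m : SobolevW Ω p}, Antitone v →
      (∀ᵐ x ∂(volume.restrict Ω), Tendsto (fun n ↦ (v n).val x) atTop (𝓝 (m.val x))) →
      ∀ n, m ≤ v n := by
    intro p v m hv hm n
    have h3 : ∀ᵐ x ∂(volume.restrict Ω), ∀ k, (v (k + 1)).val x ≤ (v k).val x :=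
      ae_all_iff.2 fun k ↦ (SobolevW.le_iff _ _).1 (hv k.le_succ)
    rw [SobolevW.le_iff]
    filter_upwards [hm, h3] with x hx hx'
    exact (antitone_nat_of_succ_le hx').le_of_tendsto hx n
  constructor
  · refine exists_minimal_of_antitone_seq (F := totalIntegral)
      (fun _ _ _ _ h ↦ ge_of_totalIntegral_le h)
      (fun h hh ↦ (abs_le.1 (abs_totalIntegral_le (hM₁ h hh) (hM₂ h hh))).1)
      (fun _ _ _ _ h ↦ totalIntegral_mono h) (fun v hv hS ↦ ?_) ⟨hu, hR⟩
    obtain ⟨m, hm, h1, h2⟩ := hlim v (Or.inr hv) hS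
    exact ⟨m, hm, fun n ↦ ⟨hge (v := fun n ↦ (v n).1) (fun i j hij ↦ (hv hij).1) h1 n,
      hge (v := fun n ↦ (v n).2) (fun i j hij ↦ (hv hij).2) h2 n⟩⟩
  · refine exists_maximal_of_monotone_seq (F := totalIntegral)
      (fun _ _ _ _ h ↦ ge_of_totalIntegral_le h)
      (fun h hh ↦ (abs_le.1 (abs_totalIntegral_le (hM₁ h hh) (hM₂ h hh))).2)
      (fun _ _ _ _ h ↦ totalIntegral_mono h) (fun v hv hS ↦ ?_) ⟨hu, hR⟩
    obtain ⟨m, hm, h1, h2⟩ := hlim v (Or.inl hv) hS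
    exact ⟨m, hm, fun n ↦ ⟨hle (v := fun n ↦ (v n).1) (fun i j hij ↦ (hv hij).1) h1 n,
      hle (v := fun n ↦ (v n).2) (fun i j hij ↦ (hv hij).2) h2 n⟩⟩

end ExtremalSolutions

theorem mainTheorem4 (N : ℕ) (hN : 1 ≤ N) (Ω : Set (RSpace N)) (hΩ : IsBoundedC2Domain Ω)
    (p₁ p₂ : ℝ) (hp₁ : 1 < p₁) (hp₂ : 1 < p₂)
    (g₁ g₂ : RSpace N → ℝ → ℝ → ℝ) (k₁ k₂ d₁ d₂ : ℝ)
    (h0₁ : HypothesisH0 Ω g₁) (h0₂ : HypothesisH0 Ω g₂)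
    (h1 : HypothesisH1 Ω g₁ g₂ k₁ k₂ d₁ d₂)
    (h2 : HypothesisH2 Ω p₁ p₂ g₁ g₂ k₁ k₂ d₁ d₂)
    (e₁ : SobolevW Ω p₁) (e₂ : SobolevW Ω p₂)
    (he₁ : IsNormalizedFirstEigenfunction e₁) (he₂ : IsNormalizedFirstEigenfunction e₂)
    (ε : ℝ) (hε : 0 < ε) :
    (∀ u : SobolevW Ω p₁ × SobolevW Ω p₂, IsWeakSolution g₁ g₂ u →
      u ∈ sobolevInterval Ω p₁ (fun x ↦ ε * e₁.val x) (fun _ ↦ k₁) ×ˢ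
        sobolevInterval Ω p₂ (fun x ↦ ε * e₂.val x) (fun _ ↦ k₂) →
      ∃ m : SobolevW Ω p₁ × SobolevW Ω p₂, m ≤ u ∧
        Minimal (fun h ↦ IsWeakSolution g₁ g₂ h ∧
          h ∈ sobolevInterval Ω p₁ (fun x ↦ ε * e₁.val x) (fun _ ↦ k₁) ×ˢ
            sobolevInterval Ω p₂ (fun x ↦ ε * e₂.val x) (fun _ ↦ k₂)) m) ∧
    (∀ v : SobolevW Ω p₁ × SobolevW Ω p₂, IsWeakSolution g₁ g₂ v →
      v ∈ sobolevInterval Ω p₁ (fun _ ↦ d₁) (fun x ↦ -(ε * e₁.val x)) ×ˢ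
        sobolevInterval Ω p₂ (fun _ ↦ d₂) (fun x ↦ -(ε * e₂.val x)) →
      ∃ m : SobolevW Ω p₁ × SobolevW Ω p₂, v ≤ m ∧
        Maximal (fun h ↦ IsWeakSolution g₁ g₂ h ∧
          h ∈ sobolevInterval Ω p₁ (fun _ ↦ d₁) (fun x ↦ -(ε * e₁.val x)) ×ˢ
            sobolevInterval Ω p₂ (fun _ ↦ d₂) (fun x ↦ -(ε * e₂.val x))) m) := by
  have hpos₁ : ∀ᵐ x ∂(volume.restrict Ω), 0 ≤ ε * e₁.val x :=
    he₁.2.1.mono fun x hx ↦ (mul_pos hε hx).le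
  have hpos₂ : ∀ᵐ x ∂(volume.restrict Ω), 0 ≤ ε * e₂.val x :=
    he₂.2.1.mono fun x hx ↦ (mul_pos hε hx).le
  refine ⟨fun u hu hR ↦ ?_, fun v hv hR ↦ ?_⟩
  · have hM₁ := le_max_left k₁ k₂
    have hM₂ := le_max_right k₁ k₂
    have := h1.k₁_pos
    refine (exists_extremal_isWeakSolution hN hΩ hp₁ hp₂ h0₁ h0₂ (M := max k₁ k₂)
      ?_ ?_ hu hR).1
    · filter_upwards [hpos₁] with x hx using ⟨by linarith, hM₁⟩
    · filter_upwards [hpos₂] with x hx using ⟨by linarith, hM₂⟩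
  · have hM₁ := min_le_left d₁ d₂
    have hM₂ := min_le_right d₁ d₂
    have := h1.d₁_neg
    refine (exists_extremal_isWeakSolution hN hΩ hp₁ hp₂ h0₁ h0₂ (M := -min d₁ d₂)
      ?_ ?_ hv hR).2
    · filter_upwards [hpos₁] with x hx using ⟨by linarith, by linarith⟩
    · filter_upwards [hpos₂] with x hx using ⟨by linarith, by linarith⟩
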